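/- **Complete M-monoids.** A complete M-monoid is a tuple $(K,\oplus,0,\Omega,\Sigma)$ where $(K,\oplus,0)$ is a commutative monoid, $\Omega$ is a ranked set of operations on $K$ that contains, for each rank $k$, the null operation (constantly $0$), and $\Sigma$ assigns to each countable family over $K$ an element of $K$ such that empty, one-element and two-element sums are the expected ones and $\Sigma_{i\in I}k_i=\Sigma_{j\in J}\Sigma_{i\in I_j}k_i$ for each countable partition $(I_j)_{j\in J}$ of $I$. It is *d-complete* if $\Sigma_{i\in\mathbb N}k_i=k$ whenever $\Sigma_{i\le n}k_i=k$ for all sufficiently large $n$. It is *distributive* if every operation distributes over $\oplus$ in each argument and $0$ is absorbing (an operation yields $0$ as soon as one argument is $0$). **wRTG-LMs.** An $S$-sorted regular tree grammar $G=(N,\Sigma,A_0,R)$ has finite nonempty sorted sets $N$ (nonterminals) and $\Sigma$ (terminals), an initial nonterminal $A_0\in N$ and a finite set $R$ of rules $A\to t$ where $t$ is a well-sorted tree over $\Sigma$ and $N$ with the sort of $A$. If $A_1\cdots A_k$ is the left-to-right string of nonterminals of $t$, then the rule has rank $k$, and $T_R$ denotes the set of all trees over $R$ in which the $i$-th child of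 each node labelled by such a rule is labelled by a rule with left-hand side $A_i$. An RTG-LM $(G,\mathcal L)$ consists of such a $G$ and an $S$-sorted $\Gamma$-algebra $\mathcal L$ with $\Sigma\subseteq\Gamma$. A *wRTG-LM* consists of an RTG-LM, a complete M-monoid $K$, and a rank-preserving map $\mathrm{wt}\colon R\to\Omega$. For $d\in T_R$ let $\mathrm{wt}(d)_K\in K$ be the value obtained by replacing each label $r$ by $\mathrm{wt}(r)$ and evaluating in $K$. **Closed.** A string $w=r_1\cdots r_m\in R^*$ is an *elementary cycle* if $m>1$, $r_1=r_m$, and neither $r_1\cdots r_{m-1}$ nor $r_2\cdots r_m$ contains a repetition. A string $\rho$ is *$(c,w)$-cyclic* if $\rho=v_0wv_1\cdots wv_c$ for some strings $v_0,\dots,v_c$ none of which contains $w$ as a substring; a leaf of a tree is $(c,w)$-cyclic if the label sequence from the root to it is so. Let $d\vdash_w d'$ if $d$ has positions $p$ and $p'$, where $p$ is a prefix of $p'$, such that the label sequence from $p$ to $p'$ is $w$ and $d'$ arises from $d$ by replacing the subtree at $p$ by the subtree at $p'$; let $\mathrm{cotrees}(d,w)=\{d'\mid d\vdash_w^+d'\}$,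 which is a finite set. A wRTG-LM is *closed* if there is a $c\in\mathbb N$ such that for every $d\in T_R$ and elementary cycle $w\in R^*$ for which $d$ has a $(c+1,w)$-cyclic leaf, $$\mathrm{wt}(d)_K\oplus\bigoplus_{d'\in\mathrm{cotrees}(d,w)}\mathrm{wt}(d')_K=\bigoplus_{d'\in\mathrm{cotrees}(d,w)}\mathrm{wt}(d')_K .$$ **Three kinds of M-monoids.** (Null operations are always included.) * *Best derivation M-monoid* $\mathbb{BD}$, for a ranked set $R_\infty$. The carrier is $[0,1]\times\mathcal P(T_{R_\infty})$; $\max_v$ takes the pair with the greater first component and, if the first components agree, unites the second components; the zero is $(0,\emptyset)$; the infinite sum of $(p_i,D_i)_{i\in I}$ is $(p,\bigcup_{i:\,p_i=p}D_i)$ with $p=\sup_i p_i$; the operations are, for $p\in[0,1]$ and $r\in R_\infty$ of rank $k$, $\mathrm{tc}_{p,r}\big((p_1,D_1),\dots,(p_k,D_k)\big)=\big(p\,p_1\cdots p_k,\ \{r(d_1,\dots,d_k)\mid d_i\in D_i\}\big)$. * *$n$-best M-monoid*, for $n\ge 1$. The carrier is the set of decreasing $n$-tuples over $[0,1]$. For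 a countable family $f$ over $[0,1]$ let $\mathrm{takenbest}(f)$ be the tuple of its $n$ greatest members, counted with multiplicity, where each entry for which no greatest remaining member exists, and all later entries, are the supremum of the remaining members (families with fewer than $n$ members are padded by $0$). The sum of two tuples, and of a countable family of tuples, is $\mathrm{takenbest}$ of the joint family of all entries; the zero is $(0,\dots,0)$; $a\cdot_n b=\mathrm{takenbest}\big((a_ib_j)_{i,j}\big)$; the operations of rank $k$ are $(a_1,\dots,a_k)\mapsto(p,0,\dots,0)\cdot_n a_1\cdot_n\cdots\cdot_n a_k$ for $p\in[0,1]$. * *Intersection M-monoid* of an RTG-LM $(G',\mathcal L')$ and $a\in\mathcal L'_{\mathrm{sort}(A_0')}$, where $G'$ is in normal form (all rules are of the form $A\to\sigma(A_1,\dots,A_k)$ with $\sigma$ a terminal) and $\mathcal L'$ is finitely decomposable (each element has only finitely many factors, a factor being an element reached by repeatedly passing from a value of an operation to one of its arguments). Let $P$ be the finite set of all rules $[A,b]\to\sigma([A_1,a_1],\dots,[A_k,a_k])$ where $A\to\sigma(A_1,\dots,A_k)$ is a rule of $G'$ and $b=\sigma_{\mathcal L'}(a_1,\dots,a_k)$ is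 a factor of $a$. The carrier is $\mathcal P(P)$, sums are unions, the zero is $\emptyset$, and for each rule $r=(A\to\sigma(A_1,\dots,A_k))$ of $G'$ there is the operation $\omega_r(V_1,\dots,V_k)=V_1\cup\dots\cup V_k\cup V$, where $V$ is the set of all $[A,b]\to\sigma([A_1,a_1],\dots,[A_k,a_k])$ in $P$ such that each $[A_i,a_i]$ is the left-hand side of a rule in $V_i$. **Theorem.** 1. Every wRTG-LM with weight algebra $\mathbb{BD}$ such that each rule $r$ has a weight $\mathrm{wt}(r)=\mathrm{tc}_{p,r'}$ with $0<p<1$ and some $r'\in R_\infty$ is closed. Moreover, $\mathbb{BD}$ is d-complete, $(0,\emptyset)$ is absorbing, and the operations $\mathrm{tc}_{p,r}$ with $p>0$ distribute over $\max_v$ on pairs with positive first components. 2. For every $n\ge1$, every wRTG-LM whose weight algebra is the $n$-best M-monoid is closed. Moreover, the $n$-best M-monoid is d-complete and distributive. 3. Every wRTG-LM whose weight algebra is an intersection M-monoid (of any RTG-LM $(G',\mathcal L')$ as above, possibly different from that of the wRTG-LM) is closed. Moreover, intersection M-monoids are d-complete and their operations distribute over union in each argument. -/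

import Mathlib

universe u v w

noncomputable section

namespace WRTG

/-! ## Trees over a ranked set -/

/-- Trees over the ranked set `R` with rank function `rk`. -/
inductive RTree {R : Type u} (rk : R → ℕ) : Type u
  | node (r : R) (ch : Fin (rk r) → RTree rk) : RTree rk

namespace RTree

variable {R : Type u} {rk : R → ℕ}

/-- The label of the root. -/
def root : RTree rk → R
  | node r _ => r

/-- The subtree `t|_p`; it is `none` iff `p` is not a position of `t`. Positions are strings of
child indices, and children are counted from `0`. -/
def sub : RTree rk → List ℕ → Option (RTree rk)
  | node r ch, [] => some (node r ch)
  | node r ch, i :: p => if h : i < rk r then sub (ch ⟨i, h⟩) p else none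

/-- The tree `t[s]_p` obtained by replacing the subtree of `t` at the position `p` by `s`. -/
def replace (s : RTree rk) : RTree rk → List ℕ → RTree rk
  | node _ _, [] => s
  | node r ch, i :: p =>
      node r (fun j => if (j : ℕ) = i then replace s (ch j) p else ch j)

/-- The label sequence `seq(t, p)` from the root to the position `p`. -/
def seq : RTree rk → List ℕ → List R
  | node r _, [] => [r]
  | node r ch, i :: p => r :: (if h : i < rk r then seq (ch ⟨i, h⟩) p else [])

/-- `p` is a leaf of `t`: a position whose label has rank `0`. -/
def IsLeaf (t : RTree rk) (p : List ℕ) : Prop :=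
  ∃ e, t.sub p = some e ∧ rk e.root = 0

end RTree

/-- Elementary cycles: the first and the last letter agree, and there are no further repetitions. -/
def IsElementaryCycle {R : Type u} (w : List R) : Prop :=
  1 < w.length ∧ w.head? = w.getLast? ∧ w.dropLast.Nodup ∧ w.tail.Nodup

/-- `ρ` is `(c, w)`-cyclic: `ρ = v₀ w v₁ ⋯ w v_c` where `w` is a substring of no `vᵢ`. -/
def IsCyclicWord {R : Type u} (c : ℕ) (w ρ : List R) : Prop :=
  ∃ v : Fin (c + 1) → List R,
    ρ = v 0 ++ (List.ofFn fun i : Fin c => w ++ v i.succ).flatten ∧ ∀ i, ¬ w <:+: v i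

namespace RTree

variable {R : Type u} {rk : R → ℕ}

/-- The relation `d ⊢_w d'`: there are positions `p` and `p q` of `d` such that the label sequence
from `p` to `p q` is `w`, and `d'` is `d` with the subtree at `p` replaced by the one at `p q`. -/
def Cut (w : List R) (d d' : RTree rk) : Prop :=
  ∃ (p q : List ℕ) (e s : RTree rk),
    d.sub p = some e ∧ e.sub q = some s ∧ e.seq q = w ∧ d' = replace s d p

/-- The set of `w`-cutout trees of `d`. -/
def cotrees (d : RTree rk) (w : List R) : Set (RTree rk) :=
  {d' | Relation.TransGen (Cut w) d d'}

/-! ### There are only finitely many cutout trees -/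

/-- The number of positions. -/
def size : RTree rk → ℕ
  | node _ ch => 1 + ∑ i, size (ch i)

theorem size_sub_le (d : RTree rk) : ∀ (p : List ℕ) (e : RTree rk), d.sub p = some e →
    e.size ≤ d.size ∧ (e.size = d.size → e = d) := by
  induction d with
  | node r ch ih =>
    intro p e h
    cases p with
    | nil => simp only [sub, Option.some.injEq] at h; subst h; simp
    | cons i p =>
      simp only [sub] at h
      split at h
      · rename_i hi
        have h1 := (ih ⟨i, hi⟩ p e h).1
        have h2 : (ch ⟨i, hi⟩).size ≤ ∑ i, (ch i).size :=
          Finset.single_le_sum (f := fun i => (ch i).size) (fun _ _ => Nat.zero_le _)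
            (Finset.mem_univ _)
        simp only [size]
        constructor
        · omega
        · intro; omega
      · simp at h

theorem size_replace (s : RTree rk) (d : RTree rk) : ∀ (p : List ℕ) (e : RTree rk),
    d.sub p = some e → (s = e → replace s d p = d) ∧
      (s.size < e.size → (replace s d p).size < d.size) := by
  induction d with
  | node r ch ih =>
    intro p e h
    cases p with
    | nil =>
      simp only [sub, Option.some.injEq] at h
      subst h
      simp [replace]
    | cons i p =>
      simp only [sub] at h
      split at h
      · rename_i hi
        obtain ⟨h1, h2⟩ := ih ⟨i, hi⟩ p e h
        constructor
        · intro hs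
          simp only [replace, node.injEq, heq_eq_eq, true_and]
          funext j
          split
          · rename_i hj
            have : j = ⟨i, hi⟩ := Fin.ext hj
            subst this
            exact h1 hs
          · rfl
        · intro hs
          have h3 := h2 hs
          simp only [replace, size, add_lt_add_iff_left]
          refine Finset.sum_lt_sum (fun j _ => ?_) ⟨⟨i, hi⟩, Finset.mem_univ _, ?_⟩
          · split
            · rename_i hj
              have : j = ⟨i, hi⟩ := Fin.ext hj
              subst this
              exact h3.le
            · exact le_rfl
          · simpa using h3
      · simp at h

theorem finite_pos (d : RTree rk) : {p | (d.sub p).isSome}.Finite := by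
  induction d with
  | node r ch ih =>
    refine Set.Finite.subset (Set.Finite.union (Set.finite_singleton [])
      (Set.finite_iUnion fun i : Fin (rk r) => (ih i).image (fun p => (i : ℕ) :: p))) ?_
    intro p hp
    cases p with
    | nil => simp
    | cons i p =>
      right
      simp only [Set.mem_ofPred_eq, sub] at hp
      split at hp
      · rename_i hi
        exact Set.mem_iUnion.2 ⟨⟨i, hi⟩, p, hp, rfl⟩
      · simp at hp

theorem finite_cut (d : RTree rk) (w : List R) : {d' | Cut w d d'}.Finite := by
  have h : {d' | Cut w d d'} ⊆ ⋃ p ∈ {p | (d.sub p).isSome},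
      ⋃ e ∈ (d.sub p).toFinset, ⋃ q ∈ {q | (e.sub q).isSome},
        ⋃ s ∈ (e.sub q).toFinset, {replace s d p} := by
    rintro d' ⟨p, q, e, s, h1, h2, -, rfl⟩
    simp only [Set.mem_iUnion, Set.mem_ofPred_eq, Option.mem_toFinset, Option.mem_def,
      Set.mem_singleton_iff]
    exact ⟨p, by simp [h1], e, h1, q, by simp [h2], s, h2, rfl⟩
  refine Set.Finite.subset ?_ h
  refine (finite_pos d).biUnion fun p _ => ?_
  refine (Finset.finite_toSet _).biUnion fun e _ => ?_
  refine (finite_pos e).biUnion fun q _ => ?_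
  exact (Finset.finite_toSet _).biUnion fun s _ => Set.finite_singleton _

theorem cotrees_finite (d : RTree rk) (w : List R) : (cotrees d w).Finite := by
  induction hn : d.size using Nat.strong_induction_on generalizing d with
  | _ n ih =>
    have hfin : ({d} ∪ ⋃ e ∈ {e | Cut w d e ∧ e.size < d.size},
        ({e} ∪ cotrees e w) : Set (RTree rk)).Finite := by
      refine (Set.finite_singleton _).union ?_
      refine ((finite_cut d w).subset fun e he => he.1).biUnion fun e he => ?_
      exact (Set.finite_singleton _).union (ih _ (hn ▸ he.2) e rfl)
    refine hfin.subset fun d' hd' => ?_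
    have step : ∀ e, Cut w d e → e = d ∨ (Cut w d e ∧ e.size < d.size) := by
      rintro e ⟨p, q, f, s, h1, h2, h3, rfl⟩
      obtain ⟨h4, h5⟩ := size_sub_le f q s h2
      obtain ⟨h6, h7⟩ := size_replace s d p f h1
      rcases h4.lt_or_eq with h | h
      · exact Or.inr ⟨⟨p, q, f, s, h1, h2, h3, rfl⟩, h7 h⟩
      · exact Or.inl (h6 (h5 h))
    have base : ∀ e, Cut w d e → e ∈ ({d} ∪ ⋃ e ∈ {e | Cut w d e ∧ e.size < d.size},
        ({e} ∪ cotrees e w) : Set (RTree rk)) := by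
      intro e he
      rcases step e he with h | h
      · exact Or.inl h
      · exact Or.inr (Set.mem_biUnion (x := e) h (Or.inl rfl))
    induction hd' with
    | single h => exact base _ h
    | tail h h' ih' =>
      rcases ih' with h1 | h1
      · exact base _ (Set.mem_singleton_iff.1 h1 ▸ h')
      · obtain ⟨e, he, h2⟩ := Set.mem_iUnion₂.1 h1
        refine Or.inr (Set.mem_biUnion (x := e) he (Or.inr ?_))
        rcases h2 with h2 | h2
        · exact Relation.TransGen.single (Set.mem_singleton_iff.1 h2 ▸ h')
        · exact Relation.TransGen.tail h2 h'

end RTree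

/-! ## Complete M-monoids -/

/-- Complete multioperator monoids. `Ω k` is the set of operation symbols of rank `k`, with the
interpretation `op`, and `null k` is the null operation. Up to bijection, the countable index sets
of the infinitary sum operation are the countable types in `Type`. -/
structure CompleteMMonoid : Type (max (v + 1) (w + 1)) where
  /-- the carrier set -/
  K : Type v
  /-- the commutative monoid `(K, ⊕, 𝟘)`, written additively -/
  addCommMonoid : AddCommMonoid K
  /-- the ranked set of operations -/
  Ω : ℕ → Type w
  /-- the interpretation of the operations -/
  op : ∀ {k : ℕ}, Ω k → (Fin k → K) → K
  /-- the null operations -/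
  null : ∀ k : ℕ, Ω k
  op_null : ∀ (k : ℕ) (a : Fin k → K), op (null k) a = 0
  /-- the infinitary sum operation -/
  infsum : ∀ {I : Type} [Countable I], (I → K) → K
  infsum_empty : ∀ {I : Type} [Countable I] [IsEmpty I] (f : I → K), infsum f = 0
  infsum_singleton : ∀ {I : Type} [Countable I] (f : I → K) (j : I), (∀ i, i = j) →
    infsum f = f j
  infsum_pair : ∀ {I : Type} [Countable I] (f : I → K) (j j' : I), j ≠ j' →
    (∀ i, i = j ∨ i = j') → infsum f = f j + f j'
  /-- the sets `{i | π i = j}` for `j ∈ J` are the blocks of a `J`-partition of `I` -/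
  infsum_partition : ∀ {I J : Type} [Countable I] [Countable J] (f : I → K) (π : I → J),
    infsum f = infsum fun j : J => infsum fun i : {i : I // π i = j} => f i

namespace CompleteMMonoid

attribute [instance] CompleteMMonoid.addCommMonoid

/-- d-completeness. -/
def DComplete (M : CompleteMMonoid.{v, w}) : Prop :=
  ∀ (k : M.K) (f : ℕ → M.K),
    (∃ n₀ : ℕ, ∀ n ≥ n₀, M.infsum (fun i : {i : ℕ // i ≤ n} => f i) = k) → M.infsum f = k

/-- Every operation distributes over `⊕` in each of its arguments. -/
def DistributesOverSum (M : CompleteMMonoid.{v, w}) : Prop :=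
  ∀ (k : ℕ) (ω : M.Ω k) (i : Fin k) (a : Fin k → M.K) (b : M.K),
    M.op ω (Function.update a i (a i + b)) = M.op ω a + M.op ω (Function.update a i b)

/-- `𝟘` is absorbing. -/
def ZeroAbsorbing (M : CompleteMMonoid.{v, w}) : Prop :=
  ∀ (k : ℕ) (ω : M.Ω k) (a : Fin k → M.K), (∃ i, a i = 0) → M.op ω a = 0

/-- Distributive M-monoids. -/
def Distributive (M : CompleteMMonoid.{v, w}) : Prop :=
  M.DistributesOverSum ∧ M.ZeroAbsorbing

end CompleteMMonoid

/-! ## Regular tree grammars and language models -/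

/-- `(S* × S)`-sorted sets. -/
structure Signature (S : Type u) where
  Op : Type u
  dom : Op → List S
  cod : Op → S

namespace Signature

variable {S : Type u} (Γ : Signature S)

/-- The rank of a symbol. -/
abbrev rank (σ : Γ.Op) : ℕ := (Γ.dom σ).length

/-- A subset of a sorted set. -/
def restrict (A : Set Γ.Op) : Signature S where
  Op := A
  dom σ := Γ.dom σ
  cod σ := Γ.cod σ

end Signature

/-- Not necessarily well-sorted trees over `Γ` and the set `N`. -/
inductive Term {S : Type u} (Γ : Signature S) (N : Type u) : Type u
  | var (A : N) : Term Γ N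
  | app (σ : Γ.Op) (ts : Fin (Γ.rank σ) → Term Γ N) : Term Γ N

namespace Term

variable {S : Type u} {Γ : Signature S} {N : Type u}

/-- `t` is a well-sorted tree of sort `s`, that is, `t ∈ T_Γ(N)_s`. -/
def HasSort (sort : N → S) : Term Γ N → S → Prop
  | var A, s => sort A = s
  | app σ ts, s => Γ.cod σ = s ∧ ∀ i, HasSort sort (ts i) ((Γ.dom σ).get i)

/-- The string of the elements of `N` in `t`, from left to right. -/
def yield : Term Γ N → List N
  | var A => [A]
  | app _ ts => (List.ofFn fun i => yield (ts i)).flatten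

end Term

/-- `S`-sorted regular tree grammars with the set `Γ` of terminals. -/
structure RTG {S : Type u} (Γ : Signature S) where
  /-- the nonterminals -/
  N : Type u
  finite_N : Finite N
  sort : N → S
  finite_terminals : Finite Γ.Op
  nonempty_terminals : Nonempty Γ.Op
  /-- the initial nonterminal -/
  A₀ : N
  /-- the rules `A → t`, as pairs `(A, t)` -/
  R : Set (N × Term Γ N)
  finite_R : R.Finite
  hasSort_of_mem : ∀ r ∈ R, r.2.HasSort sort (sort r.1)

namespace RTG

variable {S : Type u} {Γ : Signature S} (G : RTG Γ)

/-- The nonterminals on the right-hand side of a rule, from left to right. -/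
def nts (r : G.R) : List G.N := r.1.2.yield

/-- The rank of a rule. -/
def rk (r : G.R) : ℕ := (G.nts r).length

/-- `d ∈ T_R`, where the rule `A → t` with `yield_N(t) = A₁ ⋯ A_k` has the sort
`(A₁ ⋯ A_k, A)`: the `i`-th child of each node is a tree of sort `Aᵢ`. -/
def IsTree : RTree G.rk → Prop
  | .node r ch => ∀ i, (ch i).root.1.1 = (G.nts r).get i ∧ IsTree (ch i)

/-- Each right-hand side contains exactly one terminal: all rules are of the form
`A → σ(A₁, …, A_k)`. -/
def InNormalForm : Prop :=
  ∀ r ∈ G.R, ∃ (σ : Γ.Op) (B : Fin (Γ.rank σ) → G.N), r.2 = .app σ fun i => .var (B i)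

end RTG

/-- `S`-sorted `Γ`-algebras. -/
structure SortedAlgebra {S : Type u} (Γ : Signature S) where
  carrier : S → Type u
  interp : ∀ σ : Γ.Op, (∀ i : Fin (Γ.rank σ), carrier ((Γ.dom σ).get i)) → carrier (Γ.cod σ)

namespace SortedAlgebra

variable {S : Type u} {Γ : Signature S} (L : SortedAlgebra Γ)

/-- `b <_factor a`. -/
def IsFactor (b a : Σ s, L.carrier s) : Prop :=
  ∃ (σ : Γ.Op) (c : ∀ i : Fin (Γ.rank σ), L.carrier ((Γ.dom σ).get i)),
    a = ⟨Γ.cod σ, L.interp σ c⟩ ∧ ∃ i, b = ⟨(Γ.dom σ).get i, c i⟩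

/-- The set of factors of `a`. -/
def factors (a : Σ s, L.carrier s) : Set (Σ s, L.carrier s) :=
  {b | Relation.ReflTransGen L.IsFactor b a}

def FinitelyDecomposable : Prop := ∀ a, (L.factors a).Finite

end SortedAlgebra

/-- RTG-based language models: an `S`-sorted RTG with the set `terminals` of terminals and an
`S`-sorted `Γ`-algebra such that `terminals` is a subset of `Γ`. -/
structure RTGLM (S : Type u) where
  Γ : Signature S
  terminals : Set Γ.Op
  G : RTG (Γ.restrict terminals)
  L : SortedAlgebra Γ

/-- Weighted RTG-based language models with weight algebra `M`. -/
structure WRTGLM (S : Type u) (M : CompleteMMonoid.{v, w}) where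
  lm : RTGLM S
  wt : ∀ r : lm.G.R, M.Ω (lm.G.rk r)

namespace WRTGLM

variable {S : Type u} {M : CompleteMMonoid.{v, w}} (W : WRTGLM S M)

/-- The weight `wt(d)_K` of a tree: relabel it by `wt` and evaluate the result in `M`. -/
def weight : RTree W.lm.G.rk → M.K
  | .node r ch => M.op (W.wt r) fun i => weight (ch i)

/-- `W` is `c`-closed. -/
def IsCClosed (c : ℕ) : Prop :=
  ∀ (d : RTree W.lm.G.rk) (w : List W.lm.G.R), W.lm.G.IsTree d → IsElementaryCycle w →
    (∃ p, d.IsLeaf p ∧ IsCyclicWord (c + 1) w (d.seq p)) →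
    W.weight d + ∑ d' ∈ (RTree.cotrees_finite d w).toFinset, W.weight d' =
      ∑ d' ∈ (RTree.cotrees_finite d w).toFinset, W.weight d'

/-- `W` is closed. -/
def IsClosed : Prop := ∃ c, W.IsCClosed c

end WRTGLM

/-! ## The best derivation M-monoid -/

/-- The rank function of the ranked set whose elements of rank `k` are the elements of `X k`. -/
def famRk (X : ℕ → Type v) : (Σ k, X k) → ℕ := Sigma.fst

/-- Pairs of a number in `[0, 1]` and a set of trees. -/
@[ext] structure BD (X : ℕ → Type v) where
  prob : unitInterval
  trees : Set (RTree (famRk X))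

namespace BD

variable {X : ℕ → Type v}

/-- The operation `max_v`. -/
def maxv (a b : BD X) : BD X :=
  if b.prob < a.prob then a else if a.prob < b.prob then b else ⟨a.prob, a.trees ∪ b.trees⟩

/-- The infinitary sum operation. -/
def sup {I : Type} (f : I → BD X) : BD X :=
  ⟨⨆ i, (f i).prob, ⋃ i, ⋃ _ : (f i).prob = ⨆ j, (f j).prob, (f i).trees⟩

/-- The top concatenation `tc_{p,r}`. -/
def tc (p : unitInterval) {k : ℕ} (r : X k) (a : Fin k → BD X) : BD X :=
  ⟨p * ∏ i, (a i).prob, {d | ∃ e : Fin k → RTree (famRk X), (∀ i, e i ∈ (a i).trees) ∧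
    d = .node (rk := famRk X) ⟨k, r⟩ e}⟩

/-- The operations `tc_{p,r}` with `0 < p` distribute over `max_v` on tuples of pairs with positive
first components. -/
def DistributesOnPos (X : ℕ → Type v) : Prop :=
  ∀ (k : ℕ) (p : unitInterval) (r : X k) (i : Fin k) (a : Fin k → BD X) (b : BD X),
    0 < p → (∀ j, 0 < (a j).prob) → 0 < b.prob →
      tc p r (Function.update a i (maxv (a i) b)) = maxv (tc p r a) (tc p r (Function.update a i b))

/-- The operation symbols of rank `k`: the null operation and the `tc_{p,r}`. -/
inductive Op (X : ℕ → Type v) (k : ℕ) : Type v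
  | null : Op X k
  | tc (p : unitInterval) (r : X k) : Op X k

/-- The interpretation of the operation symbols. -/
def interp {k : ℕ} : Op X k → (Fin k → BD X) → BD X
  | .null, _ => ⟨0, ∅⟩
  | .tc p r, a => BD.tc p r a

@[simp] theorem maxv_prob (a b : BD X) : (maxv a b).prob = max a.prob b.prob := by
  unfold maxv
  split_ifs with h1 h2
  · exact (max_eq_left h1.le).symm
  · exact (max_eq_right h2.le).symm
  · exact (max_eq_left (not_lt.1 h2)).symm

@[simp] theorem mem_maxv_trees (a b : BD X) (d : RTree (famRk X)) : d ∈ (maxv a b).trees ↔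
    (d ∈ a.trees ∧ b.prob ≤ a.prob) ∨ (d ∈ b.trees ∧ a.prob ≤ b.prob) := by
  unfold maxv
  split_ifs with h1 h2
  · simp [h1.le, not_le.2 h1]
  · simp [h2.le, not_le.2 h2]
  · simp [not_lt.1 h1, not_lt.1 h2]

@[simp] theorem mem_sup_trees {I : Type} (f : I → BD X) (d : RTree (famRk X)) :
    d ∈ (sup f).trees ↔ ∃ i, (f i).prob = ⨆ j, (f j).prob ∧ d ∈ (f i).trees := by
  simp [sup]

instance : Add (BD X) := ⟨maxv⟩

instance : Zero (BD X) := ⟨⟨0, ∅⟩⟩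

/-- The commutative monoid of `max_v` and `(0, ∅)`. -/
instance addCommMonoid (X : ℕ → Type v) : AddCommMonoid (BD X) where
  add_assoc a b c := by
    change maxv (maxv a b) c = maxv a (maxv b c)
    ext d
    · simp [max_assoc]
    · simp only [mem_maxv_trees, maxv_prob]
      grind
  zero_add a := by
    change maxv ⟨0, ∅⟩ a = a
    ext d <;> simp
  add_zero a := by
    change maxv a ⟨0, ∅⟩ = a
    ext d <;> simp
  add_comm a b := by
    change maxv a b = maxv b a
    ext d
    · simp [max_comm]
    · simp only [mem_maxv_trees]
      tauto
  nsmul := nsmulRec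

end BD

/-- The best derivation M-monoid, where `X k` is the set of symbols of rank `k` of the ranked set
over which its trees are formed. -/
def bestDerivation (X : ℕ → Type v) : CompleteMMonoid.{v, v} where
  K := BD X
  addCommMonoid := BD.addCommMonoid X
  Ω := BD.Op X
  op := BD.interp
  null _ := .null
  op_null _ _ := rfl
  infsum := BD.sup
  infsum_empty f := by
    change BD.sup f = ⟨0, ∅⟩
    ext d
    · simp [BD.sup]
    · simp
  infsum_singleton f j h := by
    have hs : ⨆ i, (f i).prob = (f j).prob :=
      le_antisymm (iSup_le fun i => by rw [h i]) (le_iSup (fun i => (f i).prob) j)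
    ext d
    · simp [BD.sup, hs]
    · simp only [BD.mem_sup_trees, hs]
      constructor
      · rintro ⟨i, -, hd⟩
        rwa [← h i]
      · exact fun hd => ⟨j, rfl, hd⟩
  infsum_pair f j j' _ h := by
    change BD.sup f = BD.maxv (f j) (f j')
    have hs : ⨆ i, (f i).prob = max (f j).prob (f j').prob := by
      apply le_antisymm
      · refine iSup_le fun i => ?_
        rcases h i with rfl | rfl
        · exact le_max_left _ _
        · exact le_max_right _ _
      · exact max_le (le_iSup (fun i => (f i).prob) j) (le_iSup (fun i => (f i).prob) j')
    ext d
    · rw [BD.maxv_prob, ← hs]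
      rfl
    · simp only [BD.mem_sup_trees, hs, BD.mem_maxv_trees]
      constructor
      · rintro ⟨i, hi, hd⟩
        rcases h i with rfl | rfl
        · exact Or.inl ⟨hd, by rw [hi]; exact le_max_right _ _⟩
        · exact Or.inr ⟨hd, by rw [hi]; exact le_max_left _ _⟩
      · rintro (⟨hd, hl⟩ | ⟨hd, hl⟩)
        · exact ⟨j, (max_eq_left hl).symm, hd⟩
        · exact ⟨j', (max_eq_right hl).symm, hd⟩
  infsum_partition {I J} _ _ f π := by
    have hs : ⨆ i, (f i).prob = ⨆ j, ⨆ i : {i : I // π i = j}, (f i).prob := by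
      apply le_antisymm
      · exact iSup_le fun i => le_iSup_of_le (π i)
          (le_iSup (fun i' : {i' : I // π i' = π i} => (f i').prob) ⟨i, rfl⟩)
      · exact iSup_le fun j => iSup_le fun i => le_iSup (fun i => (f i).prob) i.1
    ext d
    · exact congrArg Subtype.val hs
    · simp only [BD.mem_sup_trees]
      constructor
      · rintro ⟨i, hi, hd⟩
        have h1 : (f i).prob ≤ ⨆ i' : {i' : I // π i' = π i}, (f i').prob :=
          le_iSup (fun i' : {i' : I // π i' = π i} => (f i').prob) ⟨i, rfl⟩
        have h2 : ⨆ i' : {i' : I // π i' = π i}, (f i').prob ≤ (f i).prob := by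
          rw [hi]
          exact iSup_le fun i' => le_iSup (fun i => (f i).prob) i'.1
        have h3 := le_antisymm h1 h2
        refine ⟨π i, ?_, ⟨i, rfl⟩, h3, hd⟩
        exact (h3.symm.trans hi).trans hs
      · rintro ⟨j, hj, i, hi, hd⟩
        exact ⟨i, hi.trans (hj.trans hs.symm), hd⟩

/-! ## The n-best M-monoid -/

/-- `takenbest`: the `n` greatest members of a family of numbers in `[0, 1]`, with multiplicity and
in decreasing order. The `i`-th entry (counted from `0`) is the supremum of all `t` such that more
than `i` members of the family are at least `t`; thus, as soon as no greatest member remains, all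
further entries are the supremum of the remaining members. Families with less than `n` members are
padded by `0`. -/
def takeNBest (n : ℕ) {I : Type*} (f : I → unitInterval) (i : Fin n) : unitInterval :=
  sSup {t | (i : ℕ∞) < {j | t ≤ f j}.encard}

theorem lt_takeNBest {n : ℕ} {I : Type*} (f : I → unitInterval) (i : Fin n) (t : unitInterval) :
    t < takeNBest n f i ↔ (i : ℕ∞) < {j | t < f j}.encard := by
  unfold takeNBest
  rw [lt_sSup_iff]
  constructor
  · rintro ⟨t', ht', h⟩
    exact lt_of_lt_of_le ht' (Set.encard_le_encard fun j hj => h.trans_le hj)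
  · intro h
    have h' : ((i : ℕ) + 1 : ℕ∞) ≤ Set.encard {j | t < f j} := Order.add_one_le_of_lt h
    obtain ⟨s, hs, hc⟩ := Set.exists_subset_encard_eq h'
    have hfin : s.Finite := Set.finite_of_encard_eq_coe (k := (i : ℕ) + 1) (by simpa using hc)
    have hne : s.Nonempty := by
      rw [← Set.encard_ne_zero, hc]
      simp
    obtain ⟨j, hj, hmin⟩ := Set.exists_min_image s f hfin hne
    refine ⟨f j, ?_, hs hj⟩
    have h1 : s.encard ≤ Set.encard {j' | f j ≤ f j'} := Set.encard_le_encard fun j' => hmin j'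
    rw [hc] at h1
    exact (ENat.add_one_le_iff (by simp)).1 h1

theorem takeNBest_antitone (n : ℕ) {I : Type*} (f : I → unitInterval) :
    Antitone (takeNBest n f) := by
  intro i j hij
  refine sSup_le_sSup fun t ht => ?_
  have : (i : ℕ∞) ≤ (j : ℕ∞) := by exact_mod_cast hij
  exact this.trans_lt ht

/-- Decreasing families `[n] → [0, 1]`. -/
def NBest (n : ℕ) : Type := {g : Fin n → unitInterval // Antitone g}

namespace NBest

variable {n : ℕ}

/-- `takenbest` as a map to `NBest n`. -/
def take (n : ℕ) {I : Type*} (f : I → unitInterval) : NBest n :=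
  ⟨takeNBest n f, takeNBest_antitone n f⟩

/-- The operation `max_n`. -/
def maxn (a b : NBest n) : NBest n := take n (Sum.elim a.1 b.1)

/-- The family `(0, …, 0)`. -/
def zero (n : ℕ) : NBest n := ⟨fun _ => 0, fun _ _ _ => le_rfl⟩

/-- The infinitary sum operation. -/
def sum {I : Type} (f : I → NBest n) : NBest n := take n fun x : I × Fin n => (f x.1).1 x.2

/-- The product `·_n`. -/
def mul (a b : NBest n) : NBest n := take n fun x : Fin n × Fin n => a.1 x.1 * b.1 x.2

/-- The family `(p, 0, …, 0)`. -/
def single (n : ℕ) (p : unitInterval) : NBest n :=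
  ⟨fun i => if (i : ℕ) = 0 then p else 0, fun i j hij => by
    have hij' : (i : ℕ) ≤ j := hij
    dsimp only
    split_ifs with h1 h2
    · exact le_rfl
    · omega
    · exact unitInterval.nonneg'
    · exact le_rfl⟩

/-- The operation `(a₁, …, a_k) ↦ (p, 0, …, 0) ·_n a₁ ·_n ⋯ ·_n a_k`. -/
def mulOp (p : unitInterval) {k : ℕ} (a : Fin k → NBest n) : NBest n :=
  (List.ofFn a).foldl mul (single n p)

theorem ext_lt {a b : NBest n} (h : ∀ (i : Fin n) (t : unitInterval), t < a.1 i ↔ t < b.1 i) :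
    a = b :=
  Subtype.ext (funext fun i => eq_of_forall_lt_iff fun t => h i t)

theorem lt_iff (a : NBest n) (i : Fin n) (t : unitInterval) :
    t < a.1 i ↔ (i : ℕ∞) < {j | t < a.1 j}.encard := by
  constructor
  · intro h
    have h1 : (Finset.Iic i : Set (Fin n)) ⊆ {j | t < a.1 j} := fun j hj =>
      h.trans_le (a.2 (by simpa using hj))
    have h2 := Set.encard_le_encard h1
    rw [Set.encard_coe_eq_coe_finsetCard, Fin.card_Iic] at h2
    exact lt_of_lt_of_le (by exact_mod_cast Nat.lt_succ_self _) h2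
  · intro h
    by_contra hn
    have h1 : {j | t < a.1 j} ⊆ (Finset.Iio i : Set (Fin n)) := fun j hj => by
      simp only [Finset.coe_Iio, Set.mem_Iio]
      by_contra hij
      exact hn (lt_of_lt_of_le hj (a.2 (not_lt.1 hij)))
    have h2 := Set.encard_le_encard h1
    rw [Set.encard_coe_eq_coe_finsetCard, Fin.card_Iio] at h2
    exact absurd h (not_lt.2 h2)

theorem take_self (a : NBest n) : take n a.1 = a :=
  ext_lt fun i t => (lt_takeNBest _ _ _).trans (lt_iff a i t).symm

theorem take_congr {I J : Type*} {f : I → unitInterval} {g : J → unitInterval}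
    (h : ∀ t, min (n : ℕ∞) {j | t < f j}.encard = min (n : ℕ∞) {j | t < g j}.encard) :
    take n f = take n g := by
  refine ext_lt fun i t => ?_
  have hi : (i : ℕ∞) < n := by exact_mod_cast i.2
  have := h t
  have key : ∀ c : ℕ∞, (i : ℕ∞) < c ↔ (i : ℕ∞) < min (n : ℕ∞) c := fun c => by
    rw [lt_min_iff, and_iff_right hi]
  exact ((lt_takeNBest f i t).trans ((key _).trans (this ▸ (key _).symm))).trans
    (lt_takeNBest g i t).symm

theorem encard_take {I : Type*} (f : I → unitInterval) (t : unitInterval) :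
    {i | t < (take n f).1 i}.encard = min (n : ℕ∞) {j | t < f j}.encard := by
  have h : {i | t < (take n f).1 i} = {i : Fin n | (i : ℕ∞) < {j | t < f j}.encard} :=
    Set.ext fun i => lt_takeNBest f i t
  rw [h]
  generalize {j | t < f j}.encard = c
  induction c using ENat.recTopCoe with
  | top => simp
  | coe m =>
    have h2 : {i : Fin n | (i : ℕ∞) < (m : ℕ∞)} =
        ((Finset.univ.filter fun i : Fin n => (i : ℕ) < m : Finset (Fin n)) : Set (Fin n)) := by
      ext i; simp
    rw [h2, Set.encard_coe_eq_coe_finsetCard, Fin.card_filter_val_lt]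
    norm_cast

theorem encard_elim {I J : Type*} (f : I → unitInterval) (g : J → unitInterval)
    (t : unitInterval) : {x | t < Sum.elim f g x}.encard =
      {j | t < f j}.encard + {j | t < g j}.encard := by
  have h : {x | t < Sum.elim f g x} = Sum.inl '' {j | t < f j} ∪ Sum.inr '' {j | t < g j} := by
    ext x; cases x <;> simp
  rw [h, Set.encard_union_eq, Sum.inl_injective.encard_image, Sum.inr_injective.encard_image]
  rw [Set.disjoint_left]
  rintro _ ⟨a, -, rfl⟩ ⟨b, -, h⟩
  cases h

theorem min_add (n x y : ℕ∞) : min n (min n x + y) = min n (x + y) := by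
  rcases le_total n x with h | h
  · rw [min_eq_left h, min_eq_left le_self_add, min_eq_left (h.trans le_self_add)]
  · rw [min_eq_right h]

instance : Add (NBest n) := ⟨maxn⟩

instance : Zero (NBest n) := ⟨zero n⟩

theorem maxn_comm (a b : NBest n) : maxn a b = maxn b a :=
  take_congr fun t => by rw [encard_elim, encard_elim, add_comm]

theorem zero_maxn (a : NBest n) : maxn (zero n) a = a := by
  refine Eq.trans (take_congr fun t => ?_) (take_self a)
  rw [encard_elim]
  simp [zero]

/-- The commutative monoid of `max_n` and `(0, …, 0)`. -/
instance addCommMonoid (n : ℕ) : AddCommMonoid (NBest n) where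
  add_assoc a b c := by
    refine take_congr fun t => ?_
    change min _ {j | t < Sum.elim (maxn a b).1 c.1 j}.encard =
      min _ {j | t < Sum.elim a.1 (maxn b c).1 j}.encard
    rw [encard_elim, encard_elim, maxn, maxn, encard_take, encard_take, encard_elim, encard_elim,
      min_add, add_comm {j | t < a.1 j}.encard (min _ _), min_add]
    ac_rfl
  zero_add a := zero_maxn a
  add_zero a := (maxn_comm a (zero n)).trans (zero_maxn a)
  add_comm a b := maxn_comm a b
  nsmul := nsmulRec

theorem zero_mul (a : NBest n) : mul (zero n) a = zero n := by
  refine ext_lt fun i t => (lt_takeNBest _ _ _).trans ?_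
  simp [zero]

theorem mulOp_zero {k : ℕ} (a : Fin k → NBest n) : mulOp 0 a = 0 := by
  have h : single n 0 = zero n := Subtype.ext (funext fun i => by simp [single, zero])
  unfold mulOp
  rw [h]
  generalize List.ofFn a = l
  induction l with
  | nil => rfl
  | cons b l ih => rwa [List.foldl_cons, zero_mul]

theorem encard_prod {I : Type} (f : I → NBest n) (t : unitInterval) (j : I) :
    ((fun l : Fin n => (j, l)) '' {l | t < (f j).1 l}).encard = {l | t < (f j).1 l}.encard :=
  (Prod.mk_right_injective j).encard_image _

theorem sum_singleton {I : Type} (f : I → NBest n) (j : I) (h : ∀ i, i = j) : sum f = f j := by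
  refine Eq.trans (take_congr fun t => ?_) (take_self (f j))
  rw [← encard_prod f t j]
  congr 2
  ext ⟨i, l⟩
  obtain rfl := h i
  simp

theorem sum_pair {I : Type} (f : I → NBest n) (j j' : I) (hne : j ≠ j')
    (h : ∀ i, i = j ∨ i = j') : sum f = maxn (f j) (f j') := by
  refine take_congr fun t => ?_
  rw [encard_elim, ← encard_prod f t j, ← encard_prod f t j', ← Set.encard_union_eq]
  · congr 2
    ext ⟨i, l⟩
    rcases h i with rfl | rfl
    · simp [hne.symm]
    · simp [hne]
  · rw [Set.disjoint_left]
    rintro _ ⟨a, -, rfl⟩ ⟨b, -, h⟩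
    exact hne (congrArg Prod.fst h).symm

theorem sum_partition {I J : Type} (f : I → NBest n) (π : I → J) :
    sum f = sum fun j : J => sum fun i : {i : I // π i = j} => f i := by
  refine take_congr fun t => ?_
  let A : J → Set (Fin n) := fun j => {l | t < (sum fun i : {i : I // π i = j} => f i).1 l}
  let B : ∀ j : J, Set ({i : I // π i = j} × Fin n) := fun j => {x | t < (f x.1).1 x.2}
  have hAB : ∀ j, (A j).encard = min (n : ℕ∞) (B j).encard := fun j => encard_take _ t
  let eA : {x : J × Fin n | t < (sum fun i : {i : I // π i = x.1} => f i).1 x.2} ≃ Σ j, A j :=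
    { toFun := fun x => ⟨x.1.1, x.1.2, x.2⟩
      invFun := fun x => ⟨(x.1, x.2.1), x.2.2⟩
      left_inv := fun x => rfl
      right_inv := fun x => rfl }
  let eB : {x : I × Fin n | t < (f x.1).1 x.2} ≃ Σ j, B j :=
    { toFun := fun x => ⟨π x.1.1, (⟨x.1.1, rfl⟩, x.1.2), x.2⟩
      invFun := fun x => ⟨(x.2.1.1.1, x.2.1.2), x.2.2⟩
      left_inv := fun x => rfl
      right_inv := by rintro ⟨_, ⟨⟨⟨i, rfl⟩, l⟩, h⟩⟩; rfl }
  change min _ (ENat.card _) = min _ (ENat.card _)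
  rw [ENat.card_congr eA, ENat.card_congr eB]
  by_cases hbig : ∃ j, (n : ℕ∞) ≤ (B j).encard
  · obtain ⟨j, hj⟩ := hbig
    have h1 : (n : ℕ∞) ≤ ENat.card (Σ j, B j) :=
      hj.trans (ENat.card_le_card_of_injective (α := B j) (f := fun x => Sigma.mk j x)
        fun x y h => by simpa using h)
    have h2 : (n : ℕ∞) ≤ ENat.card (Σ j, A j) := by
      refine le_trans ?_ (ENat.card_le_card_of_injective (α := A j) (f := fun x => Sigma.mk j x)
        fun x y h => by simpa using h)
      change _ ≤ (A j).encard
      rw [hAB, min_eq_left hj]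
    rw [min_eq_left h1, min_eq_left h2]
  · push Not at hbig
    have he : ∀ j, Nonempty (A j ≃ B j) := fun j => by
      have hj := hAB j
      rw [min_eq_right (hbig j).le] at hj
      have hfin : (B j).Finite := Set.encard_lt_top_iff.1 ((hbig j).trans (ENat.natCast_lt_top n))
      have := hfin.to_subtype
      have hfin' : (A j).Finite := Set.toFinite _
      have := hfin'.to_subtype
      exact Finite.card_eq.1 (congrArg ENat.toNat hj)
    rw [ENat.card_congr (Equiv.sigmaCongrRight fun j => (he j).some)]

end NBest

/-- The n-best M-monoid. Its operation symbols of rank `k` are the numbers `p` in `[0, 1]`, where `p`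
is interpreted as `(a₁, …, a_k) ↦ (p, 0, …, 0) ·_n a₁ ·_n ⋯ ·_n a_k`; the null operations are the
operations for `p = 0`. -/
def nBest (n : ℕ) : CompleteMMonoid.{0, 0} where
  K := NBest n
  addCommMonoid := NBest.addCommMonoid n
  Ω _ := unitInterval
  op p a := NBest.mulOp p a
  null _ := 0
  op_null _ a := NBest.mulOp_zero a
  infsum := NBest.sum
  infsum_empty f := NBest.ext_lt fun i t => (lt_takeNBest _ _ _).trans <| by
    change _ ↔ t < 0
    simp [Set.eq_empty_of_isEmpty {j : _ × Fin n | t < (f j.1).1 j.2}]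
  infsum_singleton := NBest.sum_singleton
  infsum_pair := NBest.sum_pair
  infsum_partition := NBest.sum_partition

/-! ## Intersection M-monoids -/

namespace RTGLM

variable {S : Type u} (M : RTGLM S)

/-- The rules `A → σ(A₁, …, A_k)` with exactly one terminal. -/
structure NFRule where
  A : M.G.N
  σ : M.terminals
  B : Fin (M.Γ.rank σ) → M.G.N
  mem : (A, Term.app (Γ := M.Γ.restrict M.terminals) σ fun i => .var (B i)) ∈ M.G.R

/-- The rules `[A, b] → σ([A₁, a₁], …, [A_k, a_k])` of `P_{R,a}`, where `A → σ(A₁, …, A_k)` is in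
`R` and `b = φ(σ)(a₁, …, a_k)` is a factor of `a`. -/
structure IntRule (a : Σ s, M.L.carrier s) where
  rule : M.NFRule
  args : ∀ i : Fin (M.Γ.rank rule.σ), M.L.carrier ((M.Γ.dom rule.σ).get i)
  mem_factors : ⟨M.Γ.cod rule.σ, M.L.interp rule.σ args⟩ ∈ M.L.factors a

variable {M} {a : Σ s, M.L.carrier s}

/-- The left-hand side `[A, b]`. -/
def IntRule.lhs (ρ : M.IntRule a) : M.G.N × Σ s, M.L.carrier s :=
  (ρ.rule.A, ⟨M.Γ.cod ρ.rule.σ, M.L.interp ρ.rule.σ ρ.args⟩)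

variable (M) in
/-- The operation symbols of rank `k`: the null operation and the `ω_r` for the rules `r` of
rank `k`. -/
inductive IntOp (k : ℕ) : Type u
  | null : IntOp k
  | omega (r : M.NFRule) (h : M.Γ.rank r.σ = k) : IntOp k

/-- The interpretation of the operation symbols:
`ω_r(V₁, …, V_k)` is the union of `V₁, …, V_k` and the set of all rules
`[A, b] → σ([A₁, a₁], …, [A_k, a_k])` in `P_{R,a}` that stem from `r = (A → σ(A₁, …, A_k))` and
such that each `[Aᵢ, aᵢ]` is a left-hand side of a rule in `Vᵢ`. -/
def IntOp.interp {k : ℕ} : M.IntOp k → (Fin k → Set (M.IntRule a)) → Set (M.IntRule a)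
  | .null, _ => ∅
  | .omega r h, V => (⋃ i, V i) ∪ {ρ | ∃ e : ρ.rule = r, ∀ i : Fin (M.Γ.rank ρ.rule.σ),
      (ρ.rule.B i, ⟨(M.Γ.dom ρ.rule.σ).get i, ρ.args i⟩) ∈
        IntRule.lhs '' V (Fin.cast ((congrArg (fun r : M.NFRule => M.Γ.rank r.σ) e).trans h) i)}

/-- Subsets of `P_{R,a}`, with union as addition. -/
@[reducible] def intAddCommMonoid : AddCommMonoid (Set (M.IntRule a)) :=
  { add := fun U V => U ∪ V
    zero := ∅
    add_assoc := Set.union_assoc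
    zero_add := Set.empty_union
    add_zero := Set.union_empty
    add_comm := Set.union_comm
    nsmul := fun n U => if n = 0 then ∅ else U
    nsmul_zero := fun U => rfl
    nsmul_succ := fun n U => by
      change (if n + 1 = 0 then ∅ else U) = (if n = 0 then ∅ else U) ∪ U
      split_ifs <;> simp_all }

/-- The intersection M-monoid of `M` and `a`. -/
def intersection (M : RTGLM S) (a : Σ s, M.L.carrier s) : CompleteMMonoid.{u, u} where
  K := Set (M.IntRule a)
  addCommMonoid := intAddCommMonoid
  Ω := M.IntOp
  op := IntOp.interp
  null _ := .null
  op_null _ _ := rfl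
  infsum f := ⋃ i, f i
  infsum_empty f := Set.iUnion_of_empty f
  infsum_singleton f j h := by
    ext x
    simp only [Set.mem_iUnion]
    exact ⟨fun ⟨i, hi⟩ => h i ▸ hi, fun hx => ⟨j, hx⟩⟩
  infsum_pair f j j' _ h := by
    change _ = f j ∪ f j'
    ext x
    simp only [Set.mem_iUnion, Set.mem_union]
    constructor
    · rintro ⟨i, hi⟩
      rcases h i with rfl | rfl
      · exact Or.inl hi
      · exact Or.inr hi
    · rintro (hx | hx)
      · exact ⟨j, hx⟩
      · exact ⟨j', hx⟩
  infsum_partition f π := by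
    ext x
    simp only [Set.mem_iUnion]
    exact ⟨fun ⟨i, hi⟩ => ⟨π i, ⟨i, rfl⟩, hi⟩, fun ⟨_, i, hi⟩ => ⟨i.1, hi⟩⟩

end RTGLM

end WRTG

end

/-!
Closedness follows in each case from what happens to the weight of a derivation `d` when an
occurrence of an elementary cycle `w` on a path to a leaf is cut out. Of the decomposition of the
leaf's label sequence only the `c + 1` disjoint occurrences of `w` matter (`HasOccurrences`). The
first one leads from a subtree `e` to a proper subtree `s` of `e` whose path contains the other
ones (`RTree.exists_first_occurrence`); replacing `e` by `s` is a cut, and so is every further cut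
inside `s`.

* Best derivations: the probability of a derivation is the product of the probabilities of its rules
  (`RTree.prodWeight`), which lie strictly between `0` and `1`. Already one cut makes it strictly
  greater, so that the cutout tree wins under `max_v`; `c = 0` suffices.
* n-best: the greatest entry of the weight of a derivation is again the product of the probabilities
  of its rules, and cuts do not decrease it. Cutting out one, two, …, `n` occurrences gives
  `n` trees of different sizes (`RTree.exists_cotrees_finset`), so that above each threshold exceeded
  by an entry of `d` the cutout trees already provide `n` entries; `c = n - 1` suffices.
  Elements of the M-monoid are compared through the number `NBest.count t a` of entries of
  `a` above `t`. In these terms a sum is addition truncated at `n`, and multiplication by a fixed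
  element changes only the thresholds; distributivity is then the distributivity of truncated sums.
* Intersection: an operation other than the null operation returns a superset of each of
  its arguments. Along a path without null operations the weights thus increase towards the root,
  inside a finite set `P` (`RTGLM.finite_intRule`), so that among more than `|P|` occurrences of `w` at
  least one does not change the weight and can be cut out without effect. The subtree
  below a null operation does not influence the weight, so that each occurrence below one can be cut
  out without effect as well. Only one of the disjoint occurrences can meet the topmost null
  operation; `c = |P| + 1` suffices (`RTGLM.exists_cut_or_le_ncard`), and union is idempotent.
-/

namespace WRTG

/-! ### Substrings along a path -/

/-- The string `ρ` contains at least `k` pairwise disjoint occurrences of the substring `w`. -/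
def HasOccurrences {R : Type u} (w : List R) : ℕ → List R → Prop
  | 0, _ => True
  | k + 1, ρ => ∃ v ρ', ρ = v ++ (w ++ ρ') ∧ HasOccurrences w k ρ'

theorem HasOccurrences.prepend {R : Type u} {w : List R} {k : ℕ} {ρ : List R}
    (h : HasOccurrences w k ρ) (u : List R) : HasOccurrences w k (u ++ ρ) := by
  cases k with
  | zero => trivial
  | succ k =>
    obtain ⟨v, ρ', rfl, h⟩ := h
    exact ⟨u ++ v, ρ', by simp, h⟩

theorem IsCyclicWord.hasOccurrences {R : Type u} {w : List R} {c : ℕ} {ρ : List R}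
    (h : IsCyclicWord c w ρ) : HasOccurrences w c ρ := by
  obtain ⟨v, rfl, -⟩ := h
  refine HasOccurrences.prepend ?_ _
  induction c with
  | zero => trivial
  | succ c ih =>
    refine ⟨[], v 1 ++ (List.ofFn fun i : Fin c => w ++ v i.succ.succ).flatten, ?_, ?_⟩
    · simp [List.ofFn_succ]
    · exact (ih fun i => v i.succ).prepend _

theorem IsElementaryCycle.ne_nil {R : Type u} {w : List R} (h : IsElementaryCycle w) : w ≠ [] := by
  rintro rfl
  simp [IsElementaryCycle] at h

namespace RTree

variable {R : Type u} {rk : R → ℕ}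

/-! ### Subtrees and replacement -/

theorem replace_self {d : RTree rk} {p : List ℕ} {e : RTree rk} (h : d.sub p = some e) :
    replace e d p = d :=
  (size_replace e d p e h).1 rfl

theorem replace_append (x : RTree rk) (d : RTree rk) (p q : List ℕ) (e : RTree rk)
    (h : d.sub p = some e) : replace x d (p ++ q) = replace (replace x e q) d p := by
  induction p generalizing d with
  | nil =>
    cases d with
    | node r ch =>
      simp only [sub, Option.some.injEq] at h
      subst h
      simp [replace]
  | cons i p ih =>
    cases d with
    | node r ch =>
      simp only [sub] at h
      split at h
      · rename_i hi
        simp only [List.cons_append, replace, node.injEq, heq_eq_eq, true_and]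
        funext j
        split
        · rename_i hj
          obtain rfl : j = ⟨i, hi⟩ := Fin.ext hj
          exact ih _ h
        · rfl
      · simp at h

theorem sub_append (d : RTree rk) (p q : List ℕ) (e : RTree rk) (h : d.sub p = some e) :
    d.sub (p ++ q) = e.sub q := by
  induction p generalizing d with
  | nil =>
    cases d with
    | node r ch =>
      simp only [sub, Option.some.injEq] at h
      subst h
      rfl
  | cons i p ih =>
    cases d with
    | node r ch =>
      simp only [sub] at h
      split at h
      · rename_i hi
        simp only [List.cons_append, sub, hi, dite_true]
        exact ih _ h
      · simp at h

theorem sub_replace (x : RTree rk) (d : RTree rk) (p : List ℕ) (e : RTree rk)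
    (h : d.sub p = some e) : (replace x d p).sub p = some x := by
  induction p generalizing d with
  | nil => cases d; cases x; simp [replace, sub]
  | cons i p ih =>
    cases d with
    | node r ch =>
      simp only [sub] at h
      split at h
      · rename_i hi
        simp only [replace, sub, hi, dite_true, if_true]
        exact ih _ h
      · simp at h

theorem replace_replace (x y : RTree rk) (d : RTree rk) (p : List ℕ) :
    replace x (replace y d p) p = replace x d p := by
  induction p generalizing d with
  | nil => cases d; cases y; simp [replace]
  | cons i p ih =>
    cases d with
    | node r ch =>
      simp only [replace, node.injEq, heq_eq_eq, true_and]
      funext j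
      split
      · exact ih _
      · rfl

theorem size_sub_lt {d : RTree rk} {p : List ℕ} {e : RTree rk} (h : d.sub p = some e)
    (hp : p ≠ []) : e.size < d.size := by
  cases p with
  | nil => exact absurd rfl hp
  | cons i p =>
    cases d with
    | node r ch =>
      simp only [sub] at h
      split at h
      · rename_i hi
        have h1 := (size_sub_le _ p e h).1
        have h2 : (ch ⟨i, hi⟩).size ≤ ∑ i, (ch i).size :=
          Finset.single_le_sum (f := fun i => (ch i).size) (fun _ _ => Nat.zero_le _)
            (Finset.mem_univ _)
        simp only [size]
        omega
      · simp at h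

/-! ### Cutting along a path -/

theorem Cut.replace {w : List R} {s x d : RTree rk} {p : List ℕ} (h : Cut w s x)
    (hs : d.sub p = some s) : Cut w d (replace x d p) := by
  obtain ⟨p', q, e, s', h1, h2, h3, rfl⟩ := h
  exact ⟨p ++ p', q, e, s', by rw [sub_append d p p' s hs, h1], h2, h3,
    (replace_append _ _ _ _ _ hs).symm⟩

theorem cotrees_replace {w : List R} {s x d : RTree rk} {p : List ℕ} (h : x ∈ cotrees s w)
    (hs : d.sub p = some s) : RTree.replace x d p ∈ cotrees d w := by
  induction h with
  | single h => exact .single (h.replace hs)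
  | tail _ h ih =>
    refine .tail ih ?_
    have := h.replace (sub_replace _ d p s hs)
    rwa [replace_replace] at this

/-- A suffix of a label sequence is the label sequence of a path in a subtree. -/
theorem exists_sub_of_seq_eq_append {d l : RTree rk} {p : List ℕ} (hl : d.sub p = some l)
    {v x : List R} (hx : x ≠ []) (h : d.seq p = v ++ x) :
    ∃ p₁ p₂ e, p = p₁ ++ p₂ ∧ d.sub p₁ = some e ∧ e.seq p₂ = x := by
  induction v generalizing d p with
  | nil => exact ⟨[], p, d, rfl, by cases d; rfl, h⟩
  | cons a v ih =>
    cases d with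
    | node r ch =>
      cases p with
      | nil => simp [seq, hx] at h
      | cons i p =>
        simp only [sub] at hl
        split at hl
        · rename_i hi
          simp only [seq, hi, dite_true, List.cons_append, List.cons.injEq] at h
          obtain ⟨p₁, p₂, e, rfl, h1, h2⟩ := ih hl h.2
          exact ⟨i :: p₁, p₂, e, rfl, by simpa [sub, hi] using h1, h2⟩
        · simp at hl

/-- A nonempty prefix of a label sequence is the label sequence of an initial part of the path;
its last letter labels the root of the remaining subtree. -/
theorem exists_sub_of_seq_eq_prefix {d l : RTree rk} {p : List ℕ} (hl : d.sub p = some l)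
    {w ρ : List R} (hw : w ≠ []) (h : d.seq p = w ++ ρ) :
    ∃ p₁ p₂ s b, p = p₁ ++ p₂ ∧ d.sub p₁ = some s ∧ d.seq p₁ = w ∧ s.seq p₂ = b :: ρ := by
  induction w generalizing d p with
  | nil => exact absurd rfl hw
  | cons a w ih =>
    rcases eq_or_ne w [] with rfl | hw'
    · refine ⟨[], p, d, a, rfl, by cases d; rfl, ?_, h⟩
      cases d; cases p <;> simp_all [seq]
    cases d with
    | node r ch =>
      cases p with
      | nil => simp [seq, hw'] at h
      | cons i p =>
        simp only [sub] at hl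
        split at hl
        · rename_i hi
          simp only [seq, hi, dite_true, List.cons_append, List.cons.injEq] at h
          obtain ⟨p₁, p₂, s, b, rfl, h1, h2, h3⟩ := ih hl hw' h.2
          exact ⟨i :: p₁, p₂, s, b, rfl, by simpa [sub, hi] using h1,
            by rw [seq, dif_pos hi, h2, h.1], h3⟩
        · simp at hl

/-- If the path to the position `p` contains `k + 1` disjoint occurrences of `w`, then the first of
them can be cut out, and the path below it, in the subtree `s`, contains the other `k`. -/
theorem exists_first_occurrence {d l : RTree rk} {p : List ℕ} (hl : d.sub p = some l)
    {w : List R} (hw : w ≠ []) {k : ℕ} (h : HasOccurrences w (k + 1) (d.seq p)) :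
    ∃ p₁ q e s p₂, d.sub p₁ = some e ∧ e.sub q = some s ∧ e.seq q = w ∧ s.sub p₂ = some l ∧
      HasOccurrences w k (s.seq p₂) := by
  obtain ⟨v, ρ, hv, hρ⟩ := h
  obtain ⟨p₁, p', e, rfl, h1, h2⟩ := exists_sub_of_seq_eq_append hl (by simp [hw]) hv
  rw [sub_append _ _ _ _ h1] at hl
  obtain ⟨q, p₂, s, b, rfl, h3, h4, h5⟩ := exists_sub_of_seq_eq_prefix hl hw h2
  rw [sub_append _ _ _ _ h3] at hl
  refine ⟨p₁, q, e, s, p₂, h1, h3, h4, hl, ?_⟩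
  rw [h5]
  exact hρ.prepend [b]

theorem ne_nil_of_seq_eq {e : RTree rk} {q : List ℕ} {w : List R} (h : e.seq q = w)
    (hw : 1 < w.length) : q ≠ [] := by
  rintro rfl
  cases e
  simp [← h, seq] at hw

/-! ### Products of probabilities -/

/-- The product of the numbers `g r` over all occurrences of labels `r` in a tree. -/
noncomputable def prodWeight (g : R → unitInterval) : RTree rk → unitInterval
  | node r ch => g r * ∏ i, prodWeight g (ch i)

variable {g : R → unitInterval}

theorem prodWeight_le_sub {d : RTree rk} {p : List ℕ} {e : RTree rk} (h : d.sub p = some e) :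
    d.prodWeight g ≤ e.prodWeight g := by
  induction p generalizing d with
  | nil => cases d; simp only [sub, Option.some.injEq] at h; rw [h]
  | cons i p ih =>
    cases d with
    | node r ch =>
      simp only [sub] at h
      split at h
      · rename_i hi
        refine le_trans ?_ (ih h)
        refine unitInterval.mul_le_right.trans ?_
        rw [← Finset.mul_prod_erase _ _ (Finset.mem_univ ⟨i, hi⟩)]
        exact unitInterval.mul_le_left
      · simp at h

theorem prodWeight_le_replace {d : RTree rk} {p : List ℕ} {e x : RTree rk}
    (h : d.sub p = some e) (hx : e.prodWeight g ≤ x.prodWeight g) :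
    d.prodWeight g ≤ (replace x d p).prodWeight g := by
  induction p generalizing d with
  | nil => cases d; simp only [sub, Option.some.injEq] at h; subst h; exact hx
  | cons i p ih =>
    cases d with
    | node r ch =>
      simp only [sub] at h
      split at h
      · rename_i hi
        simp only [replace, prodWeight]
        refine mul_le_mul' le_rfl (Finset.prod_le_prod' fun j _ => ?_)
        split
        · rename_i hj
          obtain rfl : j = ⟨i, hi⟩ := Fin.ext hj
          exact ih h
        · exact le_rfl
      · simp at h

theorem prodWeight_pos (hg : ∀ r, 0 < g r) (d : RTree rk) : 0 < d.prodWeight g := by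
  induction d with
  | node r ch ih => exact mul_pos (hg r) (Finset.prod_pos fun i _ => ih i)

theorem prodWeight_lt_sub (hg : ∀ r, 0 < g r) (hg' : ∀ r, g r < 1) {d : RTree rk} {p : List ℕ}
    {e : RTree rk} (h : d.sub p = some e) (hp : p ≠ []) : d.prodWeight g < e.prodWeight g := by
  cases p with
  | nil => exact absurd rfl hp
  | cons i p =>
    cases d with
    | node r ch =>
      simp only [sub] at h
      split at h
      · rename_i hi
        refine lt_of_lt_of_le ?_ (prodWeight_le_sub h)
        refine (mul_lt_of_lt_one_left (Finset.prod_pos fun i _ => prodWeight_pos hg _)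
          (hg' r)).trans_le ?_
        rw [← Finset.mul_prod_erase _ _ (Finset.mem_univ ⟨i, hi⟩)]
        exact unitInterval.mul_le_left
      · simp at h

theorem prodWeight_lt_replace (hg : ∀ r, 0 < g r) {d : RTree rk} {p : List ℕ} {e x : RTree rk}
    (h : d.sub p = some e) (hx : e.prodWeight g < x.prodWeight g) :
    d.prodWeight g < (replace x d p).prodWeight g := by
  induction p generalizing d with
  | nil => cases d; simp only [sub, Option.some.injEq] at h; subst h; exact hx
  | cons i p ih =>
    cases d with
    | node r ch =>
      simp only [sub] at h
      split at h
      · rename_i hi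
        simp only [replace, prodWeight]
        refine (mul_lt_mul_iff_of_pos_left (hg r)).2 ?_
        refine Finset.prod_lt_prod (fun j _ => prodWeight_pos hg _) (fun j _ => ?_)
          ⟨⟨i, hi⟩, Finset.mem_univ _, by simpa using ih h⟩
        split
        · rename_i hj
          obtain rfl : j = ⟨i, hi⟩ := Fin.ext hj
          exact (ih h).le
        · exact le_rfl
      · simp at h

/-- A path with `k` disjoint occurrences of `w` yields `k` different cutout trees: cut out the first
occurrence, then also the second one, and so on. Cutting does not decrease products of numbers in
`[0, 1]` over the nodes. -/
theorem exists_cotrees_finset (g : R → unitInterval) {w : List R} (hw : 1 < w.length) {k : ℕ}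
    {d l : RTree rk} {p : List ℕ} (hl : d.sub p = some l) (h : HasOccurrences w k (d.seq p)) :
    ∃ F : Finset (RTree rk), F.card = k ∧
      ∀ x ∈ F, x ∈ cotrees d w ∧ x.size < d.size ∧ d.prodWeight g ≤ x.prodWeight g := by
  classical
  induction k generalizing d p with
  | zero => exact ⟨∅, by simp⟩
  | succ k ih =>
    obtain ⟨p₁, q, e, s, p₂, h1, h2, h3, h4, h5⟩ :=
      exists_first_occurrence hl (by rintro rfl; simp at hw) h
    obtain ⟨F, hF, hF'⟩ := ih h4 h5
    have hlt : s.size < e.size := size_sub_lt h2 (ne_nil_of_seq_eq h3 hw)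
    have hinj : ∀ x y, replace x d p₁ = replace y d p₁ → x = y := fun x y hxy => by
      have := sub_replace x d p₁ e h1
      rw [hxy, sub_replace y d p₁ e h1] at this
      exact (Option.some.inj this).symm
    have hcut : Cut w d (replace s d p₁) := ⟨p₁, q, e, s, h1, h2, h3, rfl⟩
    refine ⟨(insert s F).image fun x => replace x d p₁, ?_, ?_⟩
    · rw [Finset.card_image_of_injective _ hinj, Finset.card_insert_of_notMem, hF]
      exact fun hs => lt_irrefl _ (hF' s hs).2.1
    · simp only [Finset.mem_image, Finset.mem_insert]
      rintro _ ⟨x, hx | hx, rfl⟩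
      · subst hx
        exact ⟨.single hcut, (size_replace _ d p₁ e h1).2 hlt,
          prodWeight_le_replace h1 (prodWeight_le_sub h2)⟩
      · obtain ⟨h6, h7, h8⟩ := hF' x hx
        refine ⟨?_, (size_replace _ d p₁ e h1).2 (h7.trans hlt),
          prodWeight_le_replace h1 ((prodWeight_le_sub h2).trans h8)⟩
        have := cotrees_replace h6 (sub_replace s d p₁ e h1)
        rw [replace_replace] at this
        exact Relation.TransGen.head hcut this

end RTree

/-! ### A criterion for closedness -/

/-- The defining equation of closedness holds as soon as a single cutout tree absorbs the weight
of the tree. -/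
theorem WRTGLM.weight_add_sum_cotrees {S : Type u} {M : CompleteMMonoid.{v, w}} (W : WRTGLM S M)
    {d d' : RTree W.lm.G.rk} {w : List W.lm.G.R} (hd' : d' ∈ RTree.cotrees d w)
    (h : W.weight d + W.weight d' = W.weight d') :
    W.weight d + ∑ x ∈ (RTree.cotrees_finite d w).toFinset, W.weight x =
      ∑ x ∈ (RTree.cotrees_finite d w).toFinset, W.weight x := by
  classical
  rw [← Finset.add_sum_erase _ _ ((RTree.cotrees_finite d w).mem_toFinset.2 hd'), ← add_assoc, h]

/-! ### The best derivation M-monoid -/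

namespace BD

variable {X : ℕ → Type v}

theorem sup_eq_of_partial_sups {k : BD X} {f : ℕ → BD X} {n₀ : ℕ}
    (h : ∀ n ≥ n₀, sup (fun i : {i : ℕ // i ≤ n} => f i) = k) : sup f = k := by
  have hle : ∀ i, (f i).prob ≤ k.prob := fun i => by
    rw [← h (max i n₀) (le_max_right _ _)]
    exact le_iSup (fun j : {j : ℕ // j ≤ max i n₀} => (f j).prob) ⟨i, le_max_left _ _⟩
  have hs : ⨆ i, (f i).prob = k.prob := by
    refine le_antisymm (iSup_le hle) ?_
    rw [← h n₀ le_rfl]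
    exact iSup_le fun i => le_iSup (fun i => (f i).prob) i.1
  have hs' : ∀ n ≥ n₀, ⨆ i : {i : ℕ // i ≤ n}, (f i).prob = k.prob :=
    fun n hn => congrArg prob (h n hn)
  ext d
  · exact congrArg Subtype.val hs
  · rw [mem_sup_trees, hs]
    constructor
    · rintro ⟨i, hi, hd⟩
      have hn := le_max_right i n₀
      rw [← h _ hn, mem_sup_trees]
      exact ⟨⟨i, le_max_left _ _⟩, hi.trans (hs' _ hn).symm, hd⟩
    · intro hd
      rw [← h n₀ le_rfl, mem_sup_trees, hs' n₀ le_rfl] at hd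
      obtain ⟨i, hi, hd⟩ := hd
      exact ⟨i, hi, hd⟩

theorem bestDerivation_dComplete : (bestDerivation X).DComplete :=
  fun _ _ ⟨_, h⟩ => sup_eq_of_partial_sups h

theorem bestDerivation_zeroAbsorbing : (bestDerivation X).ZeroAbsorbing := by
  rintro k (_ | ⟨p, r⟩) a ⟨i, hi⟩
  · rfl
  · change tc p r a = ⟨0, ∅⟩
    change a i = ⟨0, ∅⟩ at hi
    ext d
    · change ((p * ∏ j, (a j).prob : unitInterval) : ℝ) = _
      rw [Finset.prod_eq_zero (Finset.mem_univ i) (by rw [hi]), mul_zero]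
    · simp only [tc, Set.mem_ofPred_eq, Set.mem_empty_iff_false, iff_false]
      rintro ⟨e, he, -⟩
      simpa [hi] using he i

theorem maxv_eq_right {a b : BD X} (h : a.prob < b.prob) : maxv a b = b := by
  rw [maxv, if_neg h.not_gt, if_pos h]

theorem prod_update_prob {k : ℕ} (a : Fin k → BD X) (i : Fin k) (b : BD X) :
    ∏ j, (Function.update a i b j).prob = b.prob * ∏ j ∈ Finset.univ.erase i, (a j).prob := by
  rw [← Finset.mul_prod_erase _ _ (Finset.mem_univ i), Function.update_self]
  congr 1
  exact Finset.prod_congr rfl fun j hj => by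
    rw [Function.update_of_ne (Finset.ne_of_mem_erase hj)]

theorem tc_update_prob (p : unitInterval) {k : ℕ} (r : X k) (a : Fin k → BD X) (i : Fin k)
    (b : BD X) : (tc p r (Function.update a i b)).prob =
      (p * ∏ j ∈ Finset.univ.erase i, (a j).prob) * b.prob := by
  change p * _ = _
  rw [prod_update_prob]
  ac_rfl

theorem distributesOnPos : DistributesOnPos X := by
  intro k p r i a b hp ha _
  -- The probability of the `i`-th argument is multiplied by `c > 0`, which preserves and reflects
  -- the order.
  set c : unitInterval := p * ∏ j ∈ Finset.univ.erase i, (a j).prob with hc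
  have hc0 : 0 < c := mul_pos hp (Finset.prod_pos fun j _ => ha j)
  have hpa : (tc p r a).prob = c * (a i).prob := by
    rw [hc, ← tc_update_prob p r, Function.update_eq_self]
  ext d
  · refine congrArg Subtype.val ?_
    rw [maxv_prob, tc_update_prob, tc_update_prob, hpa, maxv_prob, ← hc]
    exact (mul_right_mono (a := c)).map_max
  · rw [mem_maxv_trees, tc_update_prob, hpa, ← hc, mul_le_mul_iff_of_pos_left hc0,
      mul_le_mul_iff_of_pos_left hc0]
    simp only [tc, Set.mem_ofPred_eq]
    have key : ∀ (b : BD X) (e : Fin k → RTree (famRk X)),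
        (∀ j, e j ∈ (Function.update a i b j).trees) ↔
          e i ∈ b.trees ∧ ∀ j ≠ i, e j ∈ (a j).trees := by
      intro b e
      rw [Function.forall_update_iff a fun j y => e j ∈ y.trees]
    have key' : ∀ e : Fin k → RTree (famRk X), (∀ j, e j ∈ (a j).trees) ↔
          e i ∈ (a i).trees ∧ ∀ j ≠ i, e j ∈ (a j).trees := by
      intro e
      rw [← key, Function.update_eq_self]
    simp only [key, key', mem_maxv_trees]
    constructor
    · rintro ⟨e, ⟨⟨h1, h2⟩ | ⟨h1, h2⟩, h3⟩, rfl⟩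
      · exact Or.inl ⟨⟨e, ⟨h1, h3⟩, rfl⟩, h2⟩
      · exact Or.inr ⟨⟨e, ⟨h1, h3⟩, rfl⟩, h2⟩
    · rintro (⟨⟨e, ⟨h1, h3⟩, rfl⟩, h2⟩ | ⟨⟨e, ⟨h1, h3⟩, rfl⟩, h2⟩)
      · exact ⟨e, ⟨Or.inl ⟨h1, h2⟩, h3⟩, rfl⟩
      · exact ⟨e, ⟨Or.inr ⟨h1, h2⟩, h3⟩, rfl⟩

/-- Cutting out a single occurrence of an elementary cycle strictly increases the probability of a
derivation, so the cutout tree wins under `max_v`. -/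
theorem isClosed_bestDerivation {S : Type u} (W : WRTGLM S (bestDerivation X))
    (hW : ∀ r, ∃ (p : unitInterval) (x : X (W.lm.G.rk r)), 0 < p ∧ p < 1 ∧ W.wt r = .tc p x) :
    W.IsClosed := by
  choose g x hg hg' hwt using hW
  have hprob : ∀ d, BD.prob (W.weight d) = d.prodWeight g := by
    intro d
    induction d with
    | node r ch ih =>
      change BD.prob (interp (W.wt r) fun i => W.weight (ch i)) = _
      rw [hwt]
      exact congrArg (g r * ·) (Finset.prod_congr rfl fun i _ => ih i)
  refine ⟨0, fun d w _ hw ⟨p, ⟨l, hl, _⟩, hp⟩ => ?_⟩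
  obtain ⟨p₁, q, e, s, p₂, h1, h2, h3, -, -⟩ :=
    RTree.exists_first_occurrence hl hw.ne_nil hp.hasOccurrences
  refine W.weight_add_sum_cotrees (d' := RTree.replace s d p₁)
    (.single ⟨p₁, q, e, s, h1, h2, h3, rfl⟩) ?_
  have hlt := RTree.prodWeight_lt_replace hg h1
    (RTree.prodWeight_lt_sub hg hg' h2 (RTree.ne_nil_of_seq_eq h3 hw.1))
  rw [← hprob, ← hprob] at hlt
  exact maxv_eq_right hlt

end BD

/-! ### The n-best M-monoid -/

namespace NBest

variable {n : ℕ}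

/-- The number of entries of `a` that exceed `t`. -/
noncomputable def count (t : unitInterval) (a : NBest n) : ℕ∞ := {i | t < a.1 i}.encard

theorem ext_count {a b : NBest n} (h : ∀ t, count t a = count t b) : a = b :=
  ext_lt fun i t => by
    rw [lt_iff a, lt_iff b]
    exact Eq.to_iff (congrArg ((i : ℕ∞) < ·) (h t))

theorem count_le (t : unitInterval) (a : NBest n) : count t a ≤ n := by
  have h := encard_take (n := n) a.1 t
  rw [take_self] at h
  change count t a = _ at h
  rw [h]
  exact min_le_left _ _

theorem count_add (t : unitInterval) (a b : NBest n) :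
    count t (a + b) = min (n : ℕ∞) (count t a + count t b) :=
  (encard_take _ t).trans (by rw [encard_elim]; rfl)

theorem one_le_count_iff (hn : 0 < n) (t : unitInterval) (a : NBest n) :
    1 ≤ count t a ↔ t < a.1 ⟨0, hn⟩ := by
  rw [lt_iff a, Order.one_le_iff_ne_zero, pos_iff_ne_zero.symm]
  exact Iff.rfl

/-- Truncating the summands does not change a truncated sum. -/
theorem min_sum {ι : Type*} (n : ℕ∞) (s : Finset ι) (f : ι → ℕ∞) :
    min n (∑ i ∈ s, min n (f i)) = min n (∑ i ∈ s, f i) := by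
  classical
  induction s using Finset.induction_on with
  | empty => simp
  | insert i s hi ih =>
    rw [Finset.sum_insert hi, Finset.sum_insert hi, min_add, add_comm, ← min_add, ih, min_add,
      add_comm]

theorem count_sum {ι : Type*} (t : unitInterval) (s : Finset ι) (f : ι → NBest n) :
    count t (∑ i ∈ s, f i) = min (n : ℕ∞) (∑ i ∈ s, count t (f i)) := by
  classical
  induction s using Finset.induction_on with
  | empty =>
    have h : {i | t < (zero n).1 i} = ∅ := by simp [zero]
    change Set.encard {i | t < (zero n).1 i} = _
    simp [h]
  | insert i s hi ih =>
    rw [Finset.sum_insert hi, Finset.sum_insert hi, count_add, ih, add_comm, min_add, add_comm]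

/-- Multiplication by a fixed number pulls back open upper rays of `[0, 1]` to open upper rays. -/
theorem exists_lt_mul_iff (t c : unitInterval) :
    ∃ t' : unitInterval, ∀ x : unitInterval, t < x * c ↔ t' < x := by
  refine ⟨sSup {x | x * c ≤ t}, fun x => ?_⟩
  constructor
  · intro h
    by_contra hx
    have hcont : Continuous fun y : unitInterval => y * c := by fun_prop
    have hclosed : _root_.IsClosed {y : unitInterval | y * c ≤ t} :=
      isClosed_le hcont continuous_const
    have hmem : sSup {y : unitInterval | y * c ≤ t} ∈ {y : unitInterval | y * c ≤ t} :=
      hclosed.sSup_mem ⟨0, by simp⟩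
    exact absurd (lt_of_lt_of_le h (mul_le_mul' (not_lt.1 hx) le_rfl)) (not_lt.2 hmem)
  · intro h
    by_contra hx
    exact absurd h (not_lt.2 (le_sSup (not_lt.1 hx)))

theorem encard_prod_fiberwise {I : Type} (P : I → Fin n → Prop) :
    {x : I × Fin n | P x.1 x.2}.encard = ∑ j, {i | P i j}.encard := by
  have h : {x : I × Fin n | P x.1 x.2} =
      ⋃ j ∈ (Set.univ : Set (Fin n)), (fun i => (i, j)) '' {i | P i j} := by
    ext ⟨i, j⟩
    simp
  rw [h, Set.finite_univ.encard_biUnion, finsum_mem_univ, finsum_eq_sum_of_fintype]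
  · exact Finset.sum_congr rfl fun j _ =>
      Function.Injective.encard_image (fun x y hxy => congrArg Prod.fst hxy) _
  · intro j _ j' _ hne
    rw [Function.onFun, Set.disjoint_left]
    rintro _ ⟨a, -, rfl⟩ ⟨b, -, hb⟩
    exact hne (congrArg Prod.snd hb).symm

/-- Multiplying by `c` amounts to counting with one new threshold for each entry of `c`. -/
theorem count_mul (t : unitInterval) (c : NBest n) :
    ∃ t' : Fin n → unitInterval, ∀ a : NBest n,
      count t (mul a c) = min (n : ℕ∞) (∑ j, count (t' j) a) := by
  choose t' ht' using fun j => exists_lt_mul_iff t (c.1 j)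
  refine ⟨t', fun a => ?_⟩
  refine (encard_take _ t).trans ?_
  rw [encard_prod_fiberwise fun i j => t < a.1 i * c.1 j]
  simp only [ht']
  rfl

theorem add_mul (a b c : NBest n) : mul (a + b) c = mul a c + mul b c := by
  refine ext_count fun t => ?_
  obtain ⟨t', ht'⟩ := count_mul t c
  simp only [count_add, ht', min_sum]
  rw [min_add, add_comm _ (min _ _), min_add, Finset.sum_add_distrib, add_comm]

theorem mul_comm (a b : NBest n) : mul a b = mul b a := by
  refine take_congr fun t => ?_
  congr 1
  rw [← (Equiv.prodComm (Fin n) (Fin n)).injective.encard_image]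
  congr 1
  ext ⟨i, j⟩
  simp [_root_.mul_comm]

theorem foldl_mul_add (l : List (NBest n)) (x y : NBest n) :
    l.foldl mul (x + y) = l.foldl mul x + l.foldl mul y := by
  induction l generalizing x y with
  | nil => rfl
  | cons b l ih => rw [List.foldl_cons, add_mul, ih]; rfl

theorem foldl_mul_zero (l : List (NBest n)) : l.foldl mul 0 = 0 := by
  induction l with
  | nil => rfl
  | cons b l ih =>
    rw [List.foldl_cons]
    exact (congrArg (List.foldl mul · l) (zero_mul b)).trans ih

theorem foldl_mul_ofFn_update_add {k : ℕ} (s : NBest n) (a : Fin k → NBest n) (i : Fin k)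
    (x y : NBest n) :
    (List.ofFn (Function.update a i (x + y))).foldl mul s =
      (List.ofFn (Function.update a i x)).foldl mul s +
        (List.ofFn (Function.update a i y)).foldl mul s := by
  induction k generalizing s with
  | zero => exact i.elim0
  | succ k ih =>
    simp only [List.ofFn_succ, List.foldl_cons]
    refine Fin.cases ?_ (fun i => ?_) i
    · simp only [Function.update_self, ne_eq, Fin.succ_ne_zero, not_false_eq_true,
        Function.update_of_ne]
      rw [mul_comm, add_mul, foldl_mul_add, mul_comm x, mul_comm y]
    · have h : ∀ z, (fun j : Fin k => Function.update a i.succ z j.succ) =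
          Function.update (fun j => a j.succ) i z := fun z =>
        Function.update_comp_eq_of_injective a (Fin.succ_injective k) i z
      simp only [h]
      rw [Function.update_of_ne (Fin.succ_ne_zero i).symm,
        Function.update_of_ne (Fin.succ_ne_zero i).symm,
        Function.update_of_ne (Fin.succ_ne_zero i).symm]
      exact ih _ _ _

theorem foldl_mul_eq_zero (l : List (NBest n)) (s : NBest n) (h : (0 : NBest n) ∈ l) :
    l.foldl mul s = 0 := by
  induction l generalizing s with
  | nil => simp at h
  | cons b l ih =>
    rw [List.foldl_cons]
    rcases List.mem_cons.1 h with rfl | h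
    · rw [mul_comm]
      exact (congrArg (List.foldl mul · l) (zero_mul s)).trans (foldl_mul_zero l)
    · exact ih _ h

theorem nBest_distributive : (nBest n).Distributive := by
  constructor
  · intro k p i a b
    change mulOp p (Function.update a i (a i + b)) = mulOp p a + mulOp p (Function.update a i b)
    have h := foldl_mul_ofFn_update_add (single n p) a i (a i) b
    have h' : Function.update a i (a i) = a := Function.update_eq_self i a
    exact h.trans (congrArg (fun a' => mulOp p a' + mulOp p (Function.update a i b)) h')
  · rintro k p a ⟨i, hi⟩
    exact foldl_mul_eq_zero _ _ (List.mem_ofFn.2 ⟨i, hi⟩)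

theorem nBest_dComplete : (nBest n).DComplete := by
  rintro k f ⟨n₀, h⟩
  change ∀ m ≥ n₀, sum (fun i : {i : ℕ // i ≤ m} => f i) = k at h
  change sum f = k
  refine ext_lt fun i t => ?_
  -- The set of entries above `t` in the full sum contains that of each partial sum.
  have emb : ∀ m, {x : {i : ℕ // i ≤ m} × Fin n | t < (f x.1).1 x.2}.encard ≤
      {x : ℕ × Fin n | t < (f x.1).1 x.2}.encard := fun m => by
    have hinj : Function.Injective fun x : {i : ℕ // i ≤ m} × Fin n => ((x.1 : ℕ), x.2) :=
      Subtype.val_injective.prodMap Function.injective_id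
    rw [← hinj.encard_image]
    refine Set.encard_le_encard ?_
    rintro _ ⟨x, hx, rfl⟩
    exact hx
  constructor
  · intro hi
    have hi := (lt_takeNBest _ _ _).1 hi
    have h' : ((i : ℕ) + 1 : ℕ∞) ≤ Set.encard {x : ℕ × Fin n | t < (f x.1).1 x.2} :=
      Order.add_one_le_of_lt hi
    obtain ⟨s, hs, hc⟩ := Set.exists_subset_encard_eq h'
    have hfin : s.Finite := Set.finite_of_encard_eq_coe (k := (i : ℕ) + 1) (by simpa using hc)
    obtain ⟨m, hm⟩ := (hfin.image Prod.fst).bddAbove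
    rw [← h (max m n₀) (le_max_right _ _)]
    refine (lt_takeNBest _ _ _).2 ?_
    refine lt_of_lt_of_le ((ENat.add_one_le_iff (by simp)).1 hc.ge) ?_
    have hinj : Function.Injective
        fun x : {i : ℕ // i ≤ max m n₀} × Fin n => ((x.1 : ℕ), x.2) :=
      Subtype.val_injective.prodMap Function.injective_id
    rw [← hinj.encard_image {x : {i : ℕ // i ≤ max m n₀} × Fin n | t < (f x.1).1 x.2}]
    refine Set.encard_le_encard fun x hx => ?_
    exact ⟨(⟨x.1, (hm ⟨x, hx, rfl⟩).trans (le_max_left _ _)⟩, x.2), hs hx, rfl⟩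
  · intro hi
    rw [← h n₀ le_rfl] at hi
    exact (lt_takeNBest _ _ _).2 (((lt_takeNBest _ _ _).1 hi).trans_le (emb n₀))

theorem mul_head (hn : 0 < n) (a b : NBest n) :
    (mul a b).1 ⟨0, hn⟩ = a.1 ⟨0, hn⟩ * b.1 ⟨0, hn⟩ := by
  refine eq_of_forall_lt_iff fun t => (lt_takeNBest _ _ _).trans ?_
  rw [Nat.cast_zero, Set.encard_pos]
  constructor
  · rintro ⟨⟨i, j⟩, hij⟩
    exact lt_of_lt_of_le hij (mul_le_mul' (a.2 (Nat.zero_le _)) (b.2 (Nat.zero_le _)))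
  · exact fun h => ⟨(⟨0, hn⟩, ⟨0, hn⟩), h⟩

theorem mulOp_head (hn : 0 < n) (p : unitInterval) {k : ℕ} (a : Fin k → NBest n) :
    (mulOp p a).1 ⟨0, hn⟩ = p * ∏ i, (a i).1 ⟨0, hn⟩ := by
  have h : ∀ (l : List (NBest n)) (s : NBest n), (l.foldl mul s).1 ⟨0, hn⟩ =
      s.1 ⟨0, hn⟩ * (l.map fun b => b.1 ⟨0, hn⟩).prod := by
    intro l
    induction l with
    | nil => intro s; simp
    | cons b l ih => intro s; rw [List.foldl_cons, ih, mul_head]; simp [mul_assoc]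
  unfold mulOp
  rw [h, List.map_ofFn, List.prod_ofFn]
  simp [single]

/-- An entry of the weight of a tree exceeds `t` iff the product of the probabilities of its rules
does. -/
theorem one_le_count_weight {S : Type u} (hn : 0 < n) (W : WRTGLM S (nBest n))
    (g : W.lm.G.R → unitInterval) (hg : ∀ r, W.wt r = g r) (t : unitInterval)
    (d : RTree W.lm.G.rk) : 1 ≤ count (n := n) t (W.weight d) ↔ t < d.prodWeight g := by
  have hhead : ∀ d, Subtype.val (p := Antitone) (W.weight d) ⟨0, hn⟩ = d.prodWeight g := by
    intro d
    induction d with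
    | node r ch ih =>
      refine (mulOp_head hn (W.wt r) fun i => W.weight (ch i)).trans ?_
      exact congrArg₂ (· * ·) (hg r) (Finset.prod_congr rfl fun i _ => ih i)
  rw [← hhead]
  exact one_le_count_iff hn t _

/-- With `n` disjoint occurrences of an elementary cycle, a derivation has `n` different cutout
trees whose greatest entries are at least its own. Hence above each threshold exceeded by an entry
of the derivation, the cutout trees already contribute `n` entries. -/
theorem isClosed_nBest {S : Type u} (hn : 0 < n) (W : WRTGLM S (nBest n)) : W.IsClosed := by
  let g : W.lm.G.R → unitInterval := fun r => W.wt r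
  have hcount := one_le_count_weight hn W g fun _ => rfl
  refine ⟨n - 1, fun d w _ hw ⟨p, ⟨l, hl, _⟩, hp⟩ => ?_⟩
  rw [Nat.sub_add_cancel hn] at hp
  obtain ⟨F, hF, hF'⟩ := RTree.exists_cotrees_finset g hw.1 hl hp.hasOccurrences
  refine ext_count (n := n) fun t => ?_
  refine (count_add t _ _).trans ?_
  rcases eq_or_ne (count (n := n) t (W.weight d)) 0 with h0 | h0
  · refine (congrArg (fun m => min (n : ℕ∞) (m + _)) h0).trans ?_
    rw [zero_add]
    exact min_eq_right (count_le _ _)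
  have hd : t < d.prodWeight g := (hcount t d).1 (Order.one_le_iff_ne_zero.2 h0)
  have hsum : count (n := n) t (∑ x ∈ (RTree.cotrees_finite d w).toFinset, W.weight x) = n := by
    refine (count_sum t _ _).trans (min_eq_left ?_)
    calc (n : ℕ∞) = ∑ x ∈ F, 1 := by simp [hF]
      _ ≤ ∑ x ∈ F, count (n := n) t (W.weight x) := Finset.sum_le_sum fun x hx =>
          (hcount t x).2 (hd.trans_le (hF' x hx).2.2)
      _ ≤ _ := Finset.sum_le_sum_of_subset fun x hx => by simpa using (hF' x hx).1
  refine Eq.trans ?_ hsum.symm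
  exact min_eq_left (hsum.symm.le.trans le_add_self)

end NBest

/-! ### Intersection M-monoids -/

namespace RTGLM

variable {S : Type v} {M : RTGLM S} {a : Σ s, M.L.carrier s}

instance finite_nfRule : Finite M.NFRule := by
  have : Finite M.G.N := M.G.finite_N
  have : Finite M.terminals := M.G.finite_terminals
  let f : M.NFRule → M.G.N × (Σ σ : M.terminals, (Fin (M.Γ.rank σ) → M.G.N)) :=
    fun r => (r.A, ⟨r.σ, r.B⟩)
  refine Finite.of_injective f ?_
  rintro ⟨A, σ, B, h⟩ ⟨A', σ', B', h'⟩ heq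
  simp only [f, Prod.mk.injEq, Sigma.mk.injEq] at heq
  obtain ⟨rfl, rfl, heq⟩ := heq
  obtain rfl := eq_of_heq heq
  rfl

/-- A rule is determined by the underlying rule of the grammar and the values at its nonterminals,
which are factors of `a`. -/
theorem finite_intRule (h : M.L.FinitelyDecomposable) : Finite (M.IntRule a) := by
  have hfac : Finite (M.L.factors a) := h a
  have hs : ∀ s, Finite {x : M.L.carrier s // (⟨s, x⟩ : Σ s, M.L.carrier s) ∈ M.L.factors a} :=
    fun s => Finite.of_injective (fun x => (⟨⟨s, x.1⟩, x.2⟩ : M.L.factors a)) fun x y hxy => by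
      simpa [Subtype.ext_iff] using hxy
  let f : M.IntRule a → Σ r : M.NFRule, ∀ i : Fin (M.Γ.rank r.σ),
      {x : M.L.carrier ((M.Γ.dom r.σ).get i) //
        (⟨_, x⟩ : Σ s, M.L.carrier s) ∈ M.L.factors a} :=
    fun ρ => ⟨ρ.rule, fun i => ⟨ρ.args i,
      Relation.ReflTransGen.head ⟨ρ.rule.σ, ρ.args, rfl, i, rfl⟩ ρ.mem_factors⟩⟩
  refine Finite.of_injective f ?_
  rintro ⟨r, x, hx⟩ ⟨r', x', hx'⟩ heq
  simp only [f, Sigma.mk.injEq] at heq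
  obtain ⟨rfl, heq⟩ := heq
  have heq := eq_of_heq heq
  obtain rfl : x = x' := funext fun i => congrArg Subtype.val (congrFun heq i)
  rfl

theorem intersection_dComplete : (M.intersection a).DComplete := by
  rintro k f ⟨n₀, h⟩
  change ∀ n ≥ n₀, (⋃ i : {i : ℕ // i ≤ n}, (f i : Set (M.IntRule a))) = k at h
  change (⋃ i, (f i : Set (M.IntRule a))) = k
  ext ρ
  constructor
  · intro hρ
    obtain ⟨i, hi⟩ := Set.mem_iUnion.1 hρ
    rw [← h (max i n₀) (le_max_right _ _)]
    exact Set.mem_iUnion.2 ⟨⟨i, le_max_left _ _⟩, hi⟩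
  · intro hρ
    rw [← h n₀ le_rfl] at hρ
    obtain ⟨i, hi⟩ := Set.mem_iUnion.1 hρ
    exact Set.mem_iUnion.2 ⟨i, hi⟩

theorem IntOp.interp_mono {k : ℕ} (ω : M.IntOp k) {V V' : Fin k → Set (M.IntRule a)}
    (h : ∀ i, V i ⊆ V' i) : ω.interp V ⊆ ω.interp V' := by
  cases ω with
  | null => exact fun _ h => h
  | omega r hr =>
    refine Set.union_subset_union (Set.iUnion_mono h) ?_
    rintro ρ ⟨e, he⟩
    exact ⟨e, fun i => Set.image_mono (h _) (he i)⟩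

theorem IntOp.interp_update_union {k : ℕ} (ω : M.IntOp k) (i : Fin k)
    (V : Fin k → Set (M.IntRule a)) (U : Set (M.IntRule a)) :
    ω.interp (Function.update V i (V i ∪ U)) =
      ω.interp V ∪ ω.interp (Function.update V i U) := by
  apply subset_antisymm
  · cases ω with
    | null => exact fun _ h => Or.inl h
    | omega r hr =>
      rintro ρ (hρ | ⟨e, he⟩)
      · obtain ⟨j, hj⟩ := Set.mem_iUnion.1 hρ
        rcases eq_or_ne j i with rfl | hji
        · rw [Function.update_self] at hj
          rcases hj with hj | hj
          · exact Or.inl (Or.inl (Set.mem_iUnion.2 ⟨j, hj⟩))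
          · exact Or.inr (Or.inl (Set.mem_iUnion.2 ⟨j, by rwa [Function.update_self]⟩))
        · rw [Function.update_of_ne hji] at hj
          exact Or.inl (Or.inl (Set.mem_iUnion.2 ⟨j, hj⟩))
      · -- Only the condition at the `i`-th argument involves the union; it selects the operand.
        obtain rfl := e
        obtain rfl := hr
        have he' := he i
        simp only [Fin.cast_eq_self] at he he'
        rw [Function.update_self, Set.image_union] at he'
        rcases he' with h | h
        · refine Or.inl (Or.inr ⟨rfl, fun j => ?_⟩)
          rcases eq_or_ne j i with rfl | hji
          · exact h
          · simpa [Function.update_of_ne hji] using he j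
        · refine Or.inr (Or.inr ⟨rfl, fun j => ?_⟩)
          rcases eq_or_ne j i with rfl | hji
          · simpa using h
          · simpa [Function.update_of_ne hji] using he j
  · refine Set.union_subset (ω.interp_mono fun j => ?_) (ω.interp_mono fun j => ?_) <;>
      rcases eq_or_ne j i with rfl | hji
    · rw [Function.update_self]; exact Set.subset_union_left
    · rw [Function.update_of_ne hji]
    · rw [Function.update_self, Function.update_self]; exact Set.subset_union_right
    · rw [Function.update_of_ne hji, Function.update_of_ne hji]

theorem intersection_distributesOverSum : (M.intersection a).DistributesOverSum :=
  fun _ ω i V U => IntOp.interp_update_union ω i V U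

variable {S' : Type u} (W : WRTGLM S' (M.intersection a))

/-- The weight of a tree, as a set of rules. -/
noncomputable def ruleSet (d : RTree W.lm.G.rk) : Set (M.IntRule a) := W.weight d

theorem ruleSet_replace_congr {d e x y : RTree W.lm.G.rk} {p : List ℕ} (hp : d.sub p = some e)
    (h : ruleSet W x = ruleSet W y) :
    ruleSet W (RTree.replace x d p) = ruleSet W (RTree.replace y d p) := by
  induction p generalizing d with
  | nil => cases d; exact h
  | cons i p ih =>
    cases d with
    | node r ch =>
      simp only [RTree.sub] at hp
      split at hp
      · rename_i hi
        refine congrArg (IntOp.interp (W.wt r)) (funext fun j => ?_)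
        change ruleSet W (if _ then _ else _) = ruleSet W (if _ then _ else _)
        split
        · rename_i hj
          obtain rfl : j = ⟨i, hi⟩ := Fin.ext hj
          exact ih hp
        · rfl
      · simp at hp

/-- The alternative is decided by whether there is a null operation above the position `p`. -/
theorem ruleSet_replace_eq_or_subset {d s : RTree W.lm.G.rk} {p : List ℕ}
    (hp : d.sub p = some s) :
    (∀ x, ruleSet W (RTree.replace x d p) = ruleSet W d) ∨ ruleSet W s ⊆ ruleSet W d := by
  induction p generalizing d with
  | nil =>
    cases d
    simp only [RTree.sub, Option.some.injEq] at hp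
    subst hp
    exact Or.inr subset_rfl
  | cons i p ih =>
    cases d with
    | node r ch =>
      simp only [RTree.sub] at hp
      split at hp
      · rename_i hi
        rcases ih hp with h | h
        · refine Or.inl fun x => congrArg (IntOp.interp (W.wt r)) (funext fun j => ?_)
          change ruleSet W (if _ then _ else _) = ruleSet W _
          split
          · rename_i hj
            obtain rfl : j = ⟨i, hi⟩ := Fin.ext hj
            exact h x
          · rfl
        · rcases hr : (show M.IntOp _ from W.wt r) with _ | ⟨r', hr'⟩
          · refine Or.inl fun x => ?_
            have hnull : ∀ ch', ruleSet W (.node r ch') = ∅ := fun ch' =>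
              congrArg (fun ω : M.IntOp _ => ω.interp (a := a) fun i => W.weight (ch' i)) hr
            exact (hnull _).trans (hnull _).symm
          · refine Or.inr (h.trans ?_)
            have homega : ruleSet W (.node r ch) =
                (IntOp.omega r' hr').interp fun i => ruleSet W (ch i) :=
              congrArg (fun ω : M.IntOp _ => ω.interp (a := a) fun i => W.weight (ch i)) hr
            rw [homega]
            exact fun ρ hρ => Or.inl (Set.mem_iUnion.2 ⟨⟨i, hi⟩, hρ⟩)
      · simp at hp

/-- Going up along a path without null operations, the weights increase, so that all but at most
`(ruleSet W d).ncard` many occurrences of `w` do not change them; any such occurrence can be cut out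
without effect. Below a null operation, cutting has no effect at all, and only one occurrence
can meet the first null operation. -/
theorem exists_cut_or_le_ncard [Finite (M.IntRule a)] {w : List W.lm.G.R} (hw : w ≠ []) {k : ℕ}
    {d l : RTree W.lm.G.rk} {p : List ℕ} (hl : d.sub p = some l)
    (h : HasOccurrences w k (d.seq p)) :
    (∃ d', RTree.Cut w d d' ∧ ruleSet W d' = ruleSet W d) ∨ k ≤ (ruleSet W d).ncard + 1 := by
  induction k generalizing d p with
  | zero => exact Or.inr (Nat.zero_le _)
  | succ k ih =>
    obtain ⟨p₁, q, e, s, p₂, h1, h2, h3, h4, h5⟩ := RTree.exists_first_occurrence hl hw h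
    have hs : d.sub (p₁ ++ q) = some s := by rw [RTree.sub_append _ _ _ _ h1, h2]
    rcases ih h4 h5 with ⟨s', hcut, hs'⟩ | hk
    · refine Or.inl ⟨RTree.replace s' d (p₁ ++ q), hcut.replace hs, ?_⟩
      rw [ruleSet_replace_congr W hs hs', RTree.replace_self hs]
    -- Is there a null operation above the first occurrence?
    rcases ruleSet_replace_eq_or_subset W h1 with hd | hd
    · exact Or.inl ⟨_, ⟨p₁, q, e, s, h1, h2, h3, rfl⟩, hd s⟩
    -- Is there a null operation inside the first occurrence? If so, any further one can be cut out.
    rcases ruleSet_replace_eq_or_subset W h2 with he | he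
    · cases k with
      | zero => exact Or.inr (Nat.le_add_left _ _)
      | succ k =>
        obtain ⟨p₁', q', e', s', -, h1', h2', h3', -, -⟩ := RTree.exists_first_occurrence h4 hw h5
        have hcut : RTree.Cut w s (RTree.replace s' s p₁') := ⟨p₁', q', e', s', h1', h2', h3', rfl⟩
        refine Or.inl ⟨_, hcut.replace hs, ?_⟩
        rw [RTree.replace_append _ _ _ _ _ h1, ruleSet_replace_congr W h1 (he _),
          RTree.replace_self h1]
    by_cases heq : ruleSet W s = ruleSet W e
    · refine Or.inl ⟨RTree.replace s d p₁, ⟨p₁, q, e, s, h1, h2, h3, rfl⟩, ?_⟩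
      rw [ruleSet_replace_congr W h1 heq, RTree.replace_self h1]
    · have h6 := Set.ncard_lt_ncard (he.ssubset_of_ne heq) (Set.toFinite _)
      have h7 := Set.ncard_le_ncard hd (Set.toFinite _)
      exact Or.inr (by omega)

theorem isClosed_intersection (h : M.L.FinitelyDecomposable) : W.IsClosed := by
  have := finite_intRule (a := a) h
  refine ⟨Nat.card (M.IntRule a) + 1, fun d w _ hw ⟨p, ⟨l, hl, _⟩, hp⟩ => ?_⟩
  rcases exists_cut_or_le_ncard W hw.ne_nil hl hp.hasOccurrences with ⟨d', hcut, hd'⟩ | hle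
  · refine W.weight_add_sum_cotrees (.single hcut) ?_
    change ruleSet W d ∪ ruleSet W d' = ruleSet W d'
    rw [hd', Set.union_self]
  · have := Set.ncard_le_card (ruleSet W d)
    omega

end RTGLM

end WRTG

open WRTG in
theorem mainTheorem9 :
    -- wRTG-LMs over the best derivation M-monoid, with all rule probabilities in `(0, 1)`
    (∀ (S : Type u) (X : ℕ → Type v) (W : WRTGLM S (bestDerivation X)),
      (∀ r, ∃ (p : unitInterval) (x : X (W.lm.G.rk r)), 0 < p ∧ p < 1 ∧ W.wt r = .tc p x) →
      (bestDerivation X).DComplete ∧ (bestDerivation X).ZeroAbsorbing ∧ BD.DistributesOnPos X ∧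
        W.IsClosed) ∧
    -- wRTG-LMs over the n-best M-monoids
    (∀ (S : Type u) (n : ℕ), 0 < n → ∀ W : WRTGLM S (nBest n),
      (nBest n).DComplete ∧ (nBest n).Distributive ∧ W.IsClosed) ∧
    -- wRTG-LMs over intersection M-monoids
    (∀ (S : Type u) (S' : Type v) (M : RTGLM S'), M.G.InNormalForm → M.L.FinitelyDecomposable →
      ∀ (a : M.L.carrier (M.G.sort M.G.A₀)) (W : WRTGLM S (M.intersection ⟨_, a⟩)),
        (M.intersection ⟨_, a⟩).DComplete ∧ (M.intersection ⟨_, a⟩).DistributesOverSum ∧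
        W.IsClosed) := by
  refine ⟨fun S X W hW => ?_, fun S n hn W => ?_, fun S S' M _ hM a W => ?_⟩
  · exact ⟨BD.bestDerivation_dComplete, BD.bestDerivation_zeroAbsorbing, BD.distributesOnPos,
      BD.isClosed_bestDerivation W hW⟩
  · exact ⟨NBest.nBest_dComplete, NBest.nBest_distributive, NBest.isClosed_nBest hn W⟩
  · exact ⟨RTGLM.intersection_dComplete, RTGLM.intersection_distributesOverSum,
      RTGLM.isClosed_intersection W hM⟩
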